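/- Let $\mathcal H$ be a separable complex Hilbert space (of finite or infinite dimension). For a bounded positive semi-definite (PSD) operator $A$ and $p>0$ let $A^p$ be defined by the functional calculus, let $A^0$ be the orthogonal projection onto $(\ker A)^\perp$, and let $\operatorname{Tr}A=\sum_i\langle e_i,Ae_i\rangle\in[0,+\infty]$, where $(e_i)_i$ is any orthonormal basis. Let $\varrho,\sigma$ be nonzero bounded PSD operators on $\mathcal H$ and let $(\alpha,z)\in(1,+\infty)\times(0,+\infty)$. Let $\mathcal B^{\alpha,z}(\mathcal H,\sigma)$ be the set of nonzero bounded PSD operators $\varrho$ for which there is a bounded operator $R$ on $\mathcal H$ with $$\varrho^{\frac{\alpha}{z}}=\sigma^{\frac{\alpha-1}{2z}}R\,\sigma^{\frac{\alpha-1}{2z}};$$ for such $\varrho$ there is exactly one PSD $R$ with this property that also satisfies $R^0\le\sigma^0$, and it is denoted by $\varrho_{\sigma,\alpha,z}$. Let $\mathcal L^{\alpha,z}(\mathcal H,\sigma)$ be the set of $\varrho\in\mathcal B^{\alpha,z}(\mathcal H,\sigma)$ with $\operatorname{Tr}\varrho_{\sigma,\alpha,z}^{z}<+\infty$, and let $$Q_{\alpha,z}(\varrho\|\sigma):=\operatorname{Tr}\varrho_{\sigma,\alpha,z}^{z}\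 \text{ if }\varrho\in\mathcal B^{\alpha,z}(\mathcal H,\sigma),\qquad Q_{\alpha,z}(\varrho\|\sigma):=+\infty\ \text{ otherwise.}$$ For bounded PSD $H$ put $$F(H):=\operatorname{Tr}\left(H^{1/2}\varrho^{\frac{\alpha}{z}}H^{1/2}\right)^{\frac{z}{\alpha}},\qquad G(H):=\operatorname{Tr}\left(H^{1/2}\sigma^{\frac{\alpha-1}{z}}H^{1/2}\right)^{\frac{z}{\alpha-1}},$$ and let $\mathcal B_{\sigma,\alpha,z}:=\{H \text{ bounded PSD}:G(H)<+\infty\}$, $\mathcal B_{\sigma,\alpha,z}^+:=\{H \text{ bounded PSD}:0<G(H)<+\infty\}$. Assume that one of the following holds: a) $\varrho\notin\mathcal B^{\alpha,z}(\mathcal H,\sigma)$; b) $\varrho\in\mathcal B^{\alpha,z}(\mathcal H,\sigma)\setminus\mathcal L^{\alpha,z}(\mathcal H,\sigma)$ and $\sigma$ is compact; c) $\varrho\in\mathcal L^{\alpha,z}(\mathcal H,\sigma)$. Then, as identities in $[-\infty,+\infty]$ with $\log 0=-\infty$ and $\log(+\infty)=+\infty$, $$Q_{\alpha,z}(\varrho\|\sigma)=\sup_{H\in\mathcal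 B_{\sigma,\alpha,z}}\left\{\alpha F(H)+(1-\alpha)G(H)\right\},\qquad(1)$$ $$\log Q_{\alpha,z}(\varrho\|\sigma)=\sup_{H\in\mathcal B_{\sigma,\alpha,z}^+}\left\{\alpha\log F(H)+(1-\alpha)\log G(H)\right\}.\qquad(2)$$ Equality in (1) still holds if the supremum is taken over $\mathcal B_{\sigma,\alpha,z}^+$. Moreover, in cases a) and b), and in case c) if $\sigma$ is compact, all three suprema (the one in (1), over $\mathcal B_{\sigma,\alpha,z}$ or over $\mathcal B_{\sigma,\alpha,z}^+$, and the one in (2)) may in addition be restricted to finite-rank $H$ without changing their values. -/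

import Mathlib

open scoped ENNReal InnerProductSpace

noncomputable section

namespace RenyiAZ

variable {E : Type*} [NormedAddCommGroup E] [InnerProductSpace ℂ E] [CompleteSpace E]

/-! ### Trace of positive semi-definite operators -/

/-- The index set of a fixed orthonormal (Hilbert) basis of `E`. -/
def onbIndex (E : Type*) [NormedAddCommGroup E] [InnerProductSpace ℂ E] [CompleteSpace E] :
    Set E :=
  (exists_hilbertBasis ℂ E).choose

/-- A fixed orthonormal (Hilbert) basis of `E`. -/
def onb (E : Type*) [NormedAddCommGroup E] [InnerProductSpace ℂ E] [CompleteSpace E] :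
    HilbertBasis (onbIndex E) ℂ E :=
  (exists_hilbertBasis ℂ E).choose_spec.choose

/-- `Tr A = ∑ᵢ ⟨eᵢ, A eᵢ⟩ ∈ [0, ∞]` for a bounded positive semi-definite operator `A`.
It does not depend on the orthonormal basis, see `Tr_eq_tsum`. -/
def Tr (A : E →L[ℂ] E) : ℝ≥0∞ :=
  ∑' i, ENNReal.ofReal (RCLike.re ⟪onb E i, A (onb E i)⟫_ℂ)

theorem ofReal_norm_sq_eq_tsum {E : Type*} [NormedAddCommGroup E] [InnerProductSpace ℂ E]
    {ι : Type*} (b : HilbertBasis ι ℂ E) (x : E) :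
    ENNReal.ofReal (‖x‖ ^ 2) = ∑' i, ENNReal.ofReal (‖⟪b i, x⟫_ℂ‖ ^ 2) := by
  have h := b.hasSum_inner_mul_inner x x
  have h2 : HasSum (fun i => ‖⟪b i, x⟫_ℂ‖ ^ 2) (‖x‖ ^ 2) := by
    have h3 := Complex.reCLM.hasSum h
    have e : (fun i => ‖⟪b i, x⟫_ℂ‖ ^ 2) =
        fun i => Complex.reCLM (⟪x, b i⟫_ℂ * ⟪b i, x⟫_ℂ) := by
      funext i
      rw [← inner_conj_symm x (b i), RCLike.conj_mul]
      simp [← Complex.ofReal_pow]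
    have e2 : Complex.reCLM ⟪x, x⟫_ℂ = ‖x‖ ^ 2 := by
      rw [inner_self_eq_norm_sq_to_K]
      simp [← Complex.ofReal_pow]
    rw [e, ← e2]
    exact h3
  rw [← h2.tsum_eq, ENNReal.ofReal_tsum_of_nonneg (fun i => by positivity) h2.summable]

theorem Tr_eq_tsum {ι : Type*} (b : HilbertBasis ι ℂ E) {A : E →L[ℂ] E} (hA : 0 ≤ A) :
    Tr A = ∑' i, ENNReal.ofReal (RCLike.re ⟪b i, A (b i)⟫_ℂ) := by
  have key : ∀ x : E, RCLike.re ⟪x, A x⟫_ℂ = ‖CFC.sqrt A x‖ ^ 2 := by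
    intro x
    have hs : (CFC.sqrt A).IsPositive :=
      (ContinuousLinearMap.nonneg_iff_isPositive _).1 (CFC.sqrt_nonneg A)
    conv_lhs => rw [← CFC.sqrt_mul_sqrt_self A hA]
    rw [mul_apply_eq_comp, ← hs.inner_left_eq_inner_right, inner_self_eq_norm_sq]
  have sw : ∀ x y : E, ‖⟪x, CFC.sqrt A y⟫_ℂ‖ = ‖⟪y, CFC.sqrt A x⟫_ℂ‖ := by
    intro x y
    have hs : (CFC.sqrt A).IsPositive :=
      (ContinuousLinearMap.nonneg_iff_isPositive _).1 (CFC.sqrt_nonneg A)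
    rw [← hs.inner_left_eq_inner_right, norm_inner_symm]
  unfold Tr
  simp_rw [key]
  calc ∑' i, ENNReal.ofReal (‖CFC.sqrt A (onb E i)‖ ^ 2)
      = ∑' i, ∑' j, ENNReal.ofReal (‖⟪b j, CFC.sqrt A (onb E i)⟫_ℂ‖ ^ 2) := by
        simp_rw [← ofReal_norm_sq_eq_tsum b]
    _ = ∑' j, ∑' i, ENNReal.ofReal (‖⟪onb E i, CFC.sqrt A (b j)⟫_ℂ‖ ^ 2) := by
        rw [ENNReal.tsum_comm]
        simp_rw [sw]
    _ = _ := by simp_rw [← ofReal_norm_sq_eq_tsum (onb E)]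

/-! ### The operator `ρ_{σ,α,z}` -/

/-- `A⁰`: the orthogonal projection onto the support `(ker A)ᗮ` of `A`. -/
def suppProj (A : E →L[ℂ] E) : E →L[ℂ] E :=
  ((LinearMap.ker (A : E →ₗ[ℂ] E))ᗮ).starProjection

/-- `𝓑^{α,z}(E, σ)`: the nonzero positive semi-definite `ρ` such that
`ρ^{α/z} = σ^{(α-1)/(2z)} R σ^{(α-1)/(2z)}` for some bounded operator `R`.
Powers of positive semi-definite operators are those of the continuous functional calculus. -/
def BSet (α z : ℝ) (σ : E →L[ℂ] E) : Set (E →L[ℂ] E) :=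
  {ρ | 0 ≤ ρ ∧ ρ ≠ 0 ∧ ∃ R : E →L[ℂ] E,
    ρ ^ (α / z) = σ ^ ((α - 1) / (2 * z)) * R * σ ^ ((α - 1) / (2 * z))}

/-- `R` is positive semi-definite, `R⁰ ≤ σ⁰` and
`ρ^{α/z} = σ^{(α-1)/(2z)} R σ^{(α-1)/(2z)}`. -/
def IsRel (α z : ℝ) (ρ σ R : E →L[ℂ] E) : Prop :=
  0 ≤ R ∧ suppProj R ≤ suppProj σ ∧
    ρ ^ (α / z) = σ ^ ((α - 1) / (2 * z)) * R * σ ^ ((α - 1) / (2 * z))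

theorem suppProj_le_iff (A B : E →L[ℂ] E) :
    suppProj A ≤ suppProj B ↔
      LinearMap.ker (B : E →ₗ[ℂ] E) ≤ LinearMap.ker (A : E →ₗ[ℂ] E) := by
  unfold suppProj
  rw [Submodule.starProjection_le_starProjection_iff]
  have hA : IsClosed (LinearMap.ker (A : E →ₗ[ℂ] E) : Set E) := A.isClosed_ker
  constructor
  · intro h
    have h2 := Submodule.orthogonal_le h
    have : CompleteSpace (LinearMap.ker (A : E →ₗ[ℂ] E)) := hA.completeSpace_coe
    exact (Submodule.le_orthogonal_orthogonal _).trans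
      (h2.trans (le_of_eq (Submodule.orthogonal_orthogonal _)))
  · exact fun h => Submodule.orthogonal_le h

theorem rpow_add_pos (σ : E →L[ℂ] E) {x y : ℝ} (hx : 0 < x) (hy : 0 < y) :
    σ ^ (x + y) = σ ^ x * σ ^ y := by
  lift x to NNReal using hx.le
  lift y to NNReal using hy.le
  have hx' : 0 < x := by exact_mod_cast hx
  have hy' : 0 < y := by exact_mod_cast hy
  rw [← NNReal.coe_add, ← CFC.nnrpow_eq_rpow hx', ← CFC.nnrpow_eq_rpow hy',
    ← CFC.nnrpow_eq_rpow (add_pos hx' hy'), CFC.nnrpow_add hx' hy']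

theorem isPositive_rpow (σ : E →L[ℂ] E) (p : ℝ) : (σ ^ p).IsPositive :=
  (ContinuousLinearMap.nonneg_iff_isPositive _).1 CFC.rpow_nonneg

theorem rpow_half_apply_eq_zero (σ : E →L[ℂ] E) {p : ℝ} (hp : 0 < p) {x : E}
    (h : (σ ^ p) x = 0) : (σ ^ (p / 2)) x = 0 := by
  have e : σ ^ p = σ ^ (p / 2) * σ ^ (p / 2) := by
    rw [← rpow_add_pos σ (half_pos hp) (half_pos hp), add_halves]
  have h2 : ⟪(σ ^ (p / 2)) x, (σ ^ (p / 2)) x⟫_ℂ = 0 := by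
    rw [(isPositive_rpow σ (p / 2)).inner_left_eq_inner_right, ← mul_apply_eq_comp,
      ← e, h, inner_zero_right]
  exact inner_self_eq_zero.1 h2

theorem rpow_apply_eq_zero (σ : E →L[ℂ] E) {p q : ℝ} (hp : 0 < p) (hq : 0 < q) {x : E}
    (h : (σ ^ p) x = 0) : (σ ^ q) x = 0 := by
  have h1 : ∀ n : ℕ, (σ ^ (p / 2 ^ n)) x = 0 := by
    intro n
    induction n with
    | zero => simpa using h
    | succ n ih =>
      have := rpow_half_apply_eq_zero σ (p := p / 2 ^ n) (by positivity) ih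
      rwa [div_div, ← pow_succ] at this
  obtain ⟨n, hn⟩ := exists_pow_lt_of_lt_one (div_pos hq hp) (by norm_num : (1 / 2 : ℝ) < 1)
  have hn' : p / 2 ^ n < q := by
    rw [lt_div_iff₀ hp] at hn
    calc p / 2 ^ n = (1 / 2) ^ n * p := by rw [one_div, inv_pow]; ring
      _ < q := hn
  have e : q = (q - p / 2 ^ n) + p / 2 ^ n := by ring
  rw [e, rpow_add_pos σ (by linarith) (by positivity), mul_apply_eq_comp, h1, map_zero]

theorem ker_rpow {σ : E →L[ℂ] E} (hσ : 0 ≤ σ) {p : ℝ} (hp : 0 < p) :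
    LinearMap.ker ((σ ^ p : E →L[ℂ] E) : E →ₗ[ℂ] E) = LinearMap.ker (σ : E →ₗ[ℂ] E) := by
  have e : σ ^ (1 : ℝ) = σ := CFC.rpow_one σ hσ
  ext x
  simp only [LinearMap.mem_ker, ContinuousLinearMap.coe_coe]
  constructor
  · intro h
    rw [← e]
    exact rpow_apply_eq_zero σ hp one_pos h
  · intro h
    rw [← e] at h
    exact rpow_apply_eq_zero σ one_pos hp h

open scoped ComplexOrder in
/-- For `ρ ∈ 𝓑^{α,z}(E, σ)` there is exactly one `R` as in `IsRel`. -/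
theorem existsUnique_isRel {α z : ℝ} (hα : 1 < α) (hz : 0 < z) {ρ σ : E →L[ℂ] E} (hσ : 0 ≤ σ)
    (hρ : ρ ∈ BSet α z σ) : ∃! R, IsRel α z ρ σ R := by
  obtain ⟨-, -, R, hR⟩ := hρ
  have hp : 0 < (α - 1) / (2 * z) := div_pos (by linarith) (by linarith)
  have hρ0 : 0 ≤ ρ ^ (α / z) := CFC.rpow_nonneg
  have hS := isPositive_rpow σ ((α - 1) / (2 * z))
  have hker := ker_rpow hσ hp
  simp only [IsRel, suppProj_le_iff, ← hker]
  generalize σ ^ ((α - 1) / (2 * z)) = S at *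
  generalize ρ ^ (α / z) = T at *
  have hsym : ∀ x y, ⟪S x, y⟫_ℂ = ⟪x, S y⟫_ℂ := hS.inner_left_eq_inner_right
  set N : Submodule ℂ E := LinearMap.ker (S : E →ₗ[ℂ] E) with hN
  have hNc : IsClosed (N : Set E) := S.isClosed_ker
  have : CompleteSpace N := hNc.completeSpace_coe
  have hcl : (LinearMap.range (S : E →ₗ[ℂ] E)).topologicalClosure = Nᗮ := by
    rw [← Submodule.orthogonal_orthogonal_eq_closure]
    congr 1
    ext x
    rw [Submodule.mem_orthogonal]
    constructor
    · intro h
      have h1 := h (S (S x)) ⟨S x, rfl⟩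
      rw [hsym] at h1
      exact inner_self_eq_zero.1 h1
    · rintro h _ ⟨y, rfl⟩
      have h0 : S x = 0 := h
      change ⟪S y, x⟫_ℂ = 0
      rw [hsym, h0, inner_zero_right]
  set P : E →L[ℂ] E := Nᗮ.starProjection with hP
  have hPmem : ∀ x, P x ∈ Nᗮ := fun x => Submodule.starProjection_apply_mem _ x
  have hPN : ∀ x ∈ N, P x = 0 := by
    intro x hx
    rw [hP, Submodule.starProjection_apply_eq_zero_iff, Submodule.orthogonal_orthogonal]
    exact hx
  have hSP : ∀ x, S (P x) = S x := by
    intro x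
    have h1 : x - P x ∈ Nᗮᗮ := Submodule.sub_starProjection_mem_orthogonal x
    rw [Submodule.orthogonal_orthogonal] at h1
    have h2 : S (x - P x) = 0 := h1
    rw [map_sub, sub_eq_zero] at h2
    exact h2.symm
  have hPS : ∀ x, P (S x) = S x := by
    intro x
    rw [hP, Submodule.starProjection_eq_self_iff, ← hcl]
    exact Submodule.le_topologicalClosure _ ⟨x, rfl⟩
  refine ⟨P * R * P, ⟨?_, ?_, ?_⟩, ?_⟩
  · have hpos : ∀ y ∈ Nᗮ, 0 ≤ ⟪y, R y⟫_ℂ := by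
      intro y hy
      rw [← hcl] at hy
      have hc : IsClosed {y : E | 0 ≤ ⟪y, R y⟫_ℂ} := by
        have : IsClosed {w : ℂ | 0 ≤ w} := isClosed_Ici
        exact this.preimage (by fun_prop)
      refine closure_minimal ?_ hc hy
      rintro _ ⟨x, rfl⟩
      change 0 ≤ ⟪S x, R (S x)⟫_ℂ
      rw [hsym]
      have h3 := ((ContinuousLinearMap.nonneg_iff_isPositive _).1 hρ0).inner_nonneg_right x
      rw [hR] at h3
      exact h3
    rw [ContinuousLinearMap.nonneg_iff_isPositive]
    have hin : ∀ x, ⟪x, (P * R * P) x⟫_ℂ = ⟪P x, R (P x)⟫_ℂ := by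
      intro x
      simp only [mul_apply_eq_comp]
      rw [hP, Submodule.inner_starProjection_left_eq_right]
    rw [ContinuousLinearMap.isPositive_iff_complex]
    intro x
    have h4 : 0 ≤ ⟪x, (P * R * P) x⟫_ℂ := by
      rw [hin]
      exact hpos _ (hPmem x)
    have h5 : 0 ≤ ⟪(P * R * P) x, x⟫_ℂ := by
      rw [← inner_conj_symm]
      exact star_nonneg_iff.2 h4
    have h6 := Complex.nonneg_iff.1 h5
    exact ⟨Complex.ext (by simp) (by simpa using h6.2), h6.1⟩
  · intro x hx
    have h1 := hPN x hx
    simp [h1]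
  · rw [hR]
    ext x
    simp only [mul_apply_eq_comp, hPS, hSP]
  · rintro R' ⟨h0, hk, hT⟩
    have hR'sym := ((ContinuousLinearMap.nonneg_iff_isPositive _).1 h0).inner_left_eq_inner_right
    have hR'P : ∀ x, R' (P x) = R' x := by
      intro x
      have h1 : x - P x ∈ Nᗮᗮ := Submodule.sub_starProjection_mem_orthogonal x
      rw [Submodule.orthogonal_orthogonal] at h1
      have h2 : R' (x - P x) = 0 := hk h1
      rw [map_sub, sub_eq_zero] at h2
      exact h2.symm
    have hR'mem : ∀ x, R' x ∈ Nᗮ := by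
      intro x
      rw [Submodule.mem_orthogonal]
      intro u hu
      have h2 : R' u = 0 := hk hu
      rw [← hR'sym, h2, inner_zero_left]
    have hzero : ∀ y ∈ Nᗮ, R' y = P (R y) := by
      intro y hy
      rw [← hcl] at hy
      have hc : IsClosed {y : E | R' y = P (R y)} :=
        isClosed_eq (by fun_prop) (by fun_prop)
      refine closure_minimal ?_ hc hy
      rintro _ ⟨x, rfl⟩
      change R' (S x) = P (R (S x))
      have h1 : S (R' (S x)) = S (P (R (S x))) := by
        rw [hSP]
        have := congrArg (fun A : E →L[ℂ] E => A x) (hT.symm.trans hR)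
        simpa using this
      have h2 : R' (S x) - P (R (S x)) ∈ N := by
        change S _ = 0
        rw [map_sub, h1, sub_self]
      have h3 : R' (S x) - P (R (S x)) ∈ Nᗮ := Submodule.sub_mem _ (hR'mem _) (hPmem _)
      exact sub_eq_zero.1 (inner_self_eq_zero.1 ((Submodule.mem_orthogonal _ _).1 h3 _ h2))
    ext x
    rw [← hR'P, hzero _ (hPmem x)]
    rfl

open Classical in
/-- `ρ_{σ,α,z}`, the unique `R` as in `IsRel` (existence and uniqueness for
`ρ ∈ 𝓑^{α,z}(E, σ)` is `existsUnique_isRel`; the value `0` otherwise is never used). -/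
def rel (α z : ℝ) (ρ σ : E →L[ℂ] E) : E →L[ℂ] E :=
  if h : ∃ R, IsRel α z ρ σ R then h.choose else 0

theorem isRel_rel {α z : ℝ} (hα : 1 < α) (hz : 0 < z) {ρ σ : E →L[ℂ] E} (hσ : 0 ≤ σ)
    (hρ : ρ ∈ BSet α z σ) : IsRel α z ρ σ (rel α z ρ σ) := by
  have h := (existsUnique_isRel hα hz hσ hρ).exists
  rw [rel, dif_pos h]
  exact h.choose_spec

/-- `𝓛^{α,z}(E, σ)`. -/
def LSet (α z : ℝ) (σ : E →L[ℂ] E) : Set (E →L[ℂ] E) :=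
  {ρ | ρ ∈ BSet α z σ ∧ Tr (rel α z ρ σ ^ z) < ∞}

open Classical in
/-- `Q_{α,z}(ρ‖σ) ∈ [0, ∞]`. -/
def Q (α z : ℝ) (ρ σ : E →L[ℂ] E) : ℝ≥0∞ :=
  if ρ ∈ BSet α z σ then Tr (rel α z ρ σ ^ z) else ∞

/-! ### The variational expressions -/

/-- `Tr (H^{1/2} A^{p} H^{1/2})^{1/p} ∈ [0, ∞]`. -/
def trConj (p : ℝ) (A H : E →L[ℂ] E) : ℝ≥0∞ :=
  Tr ((H ^ (1 / 2 : ℝ) * A ^ p * H ^ (1 / 2 : ℝ)) ^ (1 / p))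

/-- `𝓑(E)_{σ,α,z}`. -/
def HSet (α z : ℝ) (σ : E →L[ℂ] E) : Set (E →L[ℂ] E) :=
  {H | 0 ≤ H ∧ trConj ((α - 1) / z) σ H < ∞}

/-- `𝓑(E)_{σ,α,z}^+`. -/
def HSetPos (α z : ℝ) (σ : E →L[ℂ] E) : Set (E →L[ℂ] E) :=
  {H | 0 ≤ H ∧ 0 < trConj ((α - 1) / z) σ H ∧ trConj ((α - 1) / z) σ H < ∞}

/-- The set of finite-rank operators. -/
def finRank (E : Type*) [NormedAddCommGroup E] [InnerProductSpace ℂ E] : Set (E →L[ℂ] E) :=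
  {H | FiniteDimensional ℂ (LinearMap.range (H : E →ₗ[ℂ] E))}

/-- `α Tr (H^{1/2} ρ^{α/z} H^{1/2})^{z/α} + (1-α) Tr (H^{1/2} σ^{(α-1)/z} H^{1/2})^{z/(α-1)}`,
in the extended reals; the second term is finite for `H ∈ 𝓑(E)_{σ,α,z}`. -/
def obj (α z : ℝ) (ρ σ H : E →L[ℂ] E) : EReal :=
  (α : EReal) * (trConj (α / z) ρ H : EReal) +
    ((1 - α : ℝ) : EReal) * (trConj ((α - 1) / z) σ H : EReal)

/-- `α log Tr (H^{1/2} ρ^{α/z} H^{1/2})^{z/α}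
+ (1-α) log Tr (H^{1/2} σ^{(α-1)/z} H^{1/2})^{z/(α-1)}`, in the extended reals, with
`log 0 = -∞` and `log ∞ = ∞`; the second term is finite for `H ∈ 𝓑(E)_{σ,α,z}^+`. -/
def logObj (α z : ℝ) (ρ σ H : E →L[ℂ] E) : EReal :=
  (α : EReal) * ENNReal.log (trConj (α / z) ρ H) +
    ((1 - α : ℝ) : EReal) * ENNReal.log (trConj ((α - 1) / z) σ H)

end RenyiAZ

end

open scoped ENNReal InnerProductSpace

noncomputable section

namespace RenyiAZ

variable {E : Type*} [NormedAddCommGroup E] [InnerProductSpace ℂ E] [CompleteSpace E]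

open Filter Topology

set_option linter.unusedSectionVars false

/-! Write `S = σ^((α-1)/(2z))` and, when `ρ` lies in `BSet α z σ`, `ρ^(α/z) = S R S` with `R` the
relative operator. With `Y = S H^(1/2)` the two functionals become `F(H) = Tr (Y* R Y)^(z/α)` and
`G(H) = Tr (Y* Y)^(z/(α-1))`.

Upper bound: since `α/z = 1/z + (α-1)/z`, Hölder's inequality for arbitrary positive exponents
(`Tr_rpow_conj_le`) gives `F ≤ Q^(1/α) G^((α-1)/α)`. Taking logarithms yields the bound in (2);
weighted AM-GM yields the one in (1).

Lower bound: finite-rank `H` suffice. `H = Z Z*` may be used without computing its square root, and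
`S Z` can approximate any finite-rank operator with range in the closure of the range of `S`
(`exists_lt_obj`). So `Y` may be replaced by any such `C`. If `R` is compact, `C = R^((α-1)/2)` on
finitely many eigenvectors makes both traces equal to a partial sum of `Tr R^z`. If `R` is not
compact, it is bounded below on an infinite-dimensional subspace, and multiples of projections
inside it make the objective unbounded. If `R` does not exist, Douglas factorization fails, so
rank-one `H` make the objective unbounded.

The same `H` serve for (2): AM-GM shows that a large value of `obj` forces a large value of
`logObj`. -/

/-! ### Quadratic forms of positive operators. -/

/-- The quadratic form `x ↦ Re ⟨x, A x⟩` of an operator. -/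
def quadForm (A : E →L[ℂ] E) (x : E) : ℝ := RCLike.re ⟪x, A x⟫_ℂ

theorem quadForm_nonneg {A : E →L[ℂ] E} (hA : 0 ≤ A) (x : E) : 0 ≤ quadForm A x :=
  ((ContinuousLinearMap.nonneg_iff_isPositive _).1 hA).re_inner_nonneg_right x

theorem quadForm_add (A B : E →L[ℂ] E) (x : E) :
    quadForm (A + B) x = quadForm A x + quadForm B x := by
  simp [quadForm]

theorem quadForm_sub (A B : E →L[ℂ] E) (x : E) :
    quadForm (A - B) x = quadForm A x - quadForm B x := by
  simp [quadForm]

theorem quadForm_mono {A B : E →L[ℂ] E} (h : A ≤ B) (x : E) : quadForm A x ≤ quadForm B x := by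
  have h1 := quadForm_nonneg (sub_nonneg.2 h) x
  rw [quadForm_sub] at h1
  linarith

theorem quadForm_algebraMap (c : ℝ) (x : E) :
    quadForm (algebraMap ℝ (E →L[ℂ] E) c) x = c * ‖x‖ ^ 2 := by
  have h : (algebraMap ℝ (E →L[ℂ] E) c) x = (c : ℂ) • x := by
    rw [Algebra.algebraMap_eq_smul_one]
    simp
  rw [quadForm, h, inner_smul_right, ← inner_self_eq_norm_sq (𝕜 := ℂ) x]
  simp

theorem quadForm_real_smul (c : ℝ) (A : E →L[ℂ] E) (x : E) :
    quadForm (c • A) x = c * quadForm A x := by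
  have h : (c • A) x = (c : ℂ) • A x := by simp
  rw [quadForm, h, inner_smul_right, quadForm]
  simp

theorem inner_star_apply (C : E →L[ℂ] E) (x y : E) : ⟪x, (star C) y⟫_ℂ = ⟪C x, y⟫_ℂ := by
  rw [ContinuousLinearMap.star_eq_adjoint, ContinuousLinearMap.adjoint_inner_right]

theorem quadForm_star_mul_self (C : E →L[ℂ] E) (x : E) : quadForm (star C * C) x = ‖C x‖ ^ 2 := by
  rw [quadForm, mul_apply_eq_comp, inner_star_apply, inner_self_eq_norm_sq]

theorem quadForm_star_mul_mul (Y A : E →L[ℂ] E) (x : E) :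
    quadForm (star Y * A * Y) x = quadForm A (Y x) := by
  rw [quadForm, mul_apply_eq_comp, mul_apply_eq_comp, inner_star_apply, quadForm]

theorem quadForm_smul (A : E →L[ℂ] E) (c : ℂ) (x : E) :
    quadForm A (c • x) = ‖c‖ ^ 2 * quadForm A x := by
  rw [quadForm, map_smul, inner_smul_left, inner_smul_right, ← mul_assoc, RCLike.conj_mul, quadForm]
  norm_cast
  exact Complex.re_ofReal_mul _ _

theorem quadForm_of_eigenvector {A : E →L[ℂ] E} {e : E} {a : ℝ} (h : A e = (a : ℂ) • e) :
    quadForm A e = a * ‖e‖ ^ 2 := by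
  rw [quadForm, h, inner_smul_right, ← inner_self_eq_norm_sq (𝕜 := ℂ) e]
  simp

theorem star_eq_of_nonneg {A : E →L[ℂ] E} (hA : 0 ≤ A) : star A = A :=
  (IsSelfAdjoint.of_nonneg hA).star_eq

theorem inner_apply_of_nonneg {A : E →L[ℂ] E} (hA : 0 ≤ A) (x y : E) :
    ⟪A x, y⟫_ℂ = ⟪x, A y⟫_ℂ :=
  ((ContinuousLinearMap.nonneg_iff_isPositive _).1 hA).inner_left_eq_inner_right x y

theorem nonneg_of_quadForm {A : E →L[ℂ] E} (hA : IsSelfAdjoint A) (h : ∀ x, 0 ≤ quadForm A x) :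
    0 ≤ A := by
  rw [ContinuousLinearMap.nonneg_iff_isPositive, ContinuousLinearMap.isPositive_def']
  refine ⟨hA, fun x => ?_⟩
  rw [ContinuousLinearMap.reApplyInnerSelf_apply, inner_re_symm]
  exact h x

/-- `A^{p/2} A^{p/2} = A^p`. -/
theorem rpow_half_mul_rpow_half (A : E →L[ℂ] E) {p : ℝ} (hp : 0 < p) :
    A ^ (p / 2) * A ^ (p / 2) = A ^ p := by
  rw [← rpow_add_pos A (half_pos hp) (half_pos hp), add_halves]

theorem sqrt_mul_sqrt {A : E →L[ℂ] E} (hA : 0 ≤ A) :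
    A ^ (1 / 2 : ℝ) * A ^ (1 / 2 : ℝ) = A := by
  rw [rpow_half_mul_rpow_half A one_pos, CFC.rpow_one A hA]

theorem star_rpow (A : E →L[ℂ] E) (p : ℝ) : star (A ^ p) = A ^ p :=
  star_eq_of_nonneg CFC.rpow_nonneg

theorem quadForm_eq_norm_sq {A : E →L[ℂ] E} (hA : 0 ≤ A) (x : E) :
    quadForm A x = ‖(A ^ (1 / 2 : ℝ)) x‖ ^ 2 := by
  rw [← quadForm_star_mul_self, star_rpow, sqrt_mul_sqrt hA]

theorem apply_eq_zero_of_quadForm_eq_zero {A : E →L[ℂ] E} (hA : 0 ≤ A) {x : E}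
    (h : quadForm A x = 0) : A x = 0 := by
  rw [quadForm_eq_norm_sq hA] at h
  have h1 : (A ^ (1 / 2 : ℝ)) x = 0 := by simpa using h
  rw [← sqrt_mul_sqrt hA, mul_apply_eq_comp, h1, map_zero]

/-! ### Eigenvectors under the functional calculus. -/

/-- The functions `f` with this property form a closed subalgebra containing the identity, so
Stone-Weierstrass gives all of them. -/
theorem cfcHom_apply_eigenvector {A : E →L[ℂ] E} (hA : IsSelfAdjoint A) {e : E} {a : ℝ}
    (ha : a ∈ spectrum ℝ A) (h : A e = (a : ℂ) • e) (f : C(spectrum ℝ A, ℝ)) :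
    (cfcHom hA f) e = ((f ⟨a, ha⟩ : ℝ) : ℂ) • e := by
  induction f using ContinuousMap.induction_on_of_compact with
  | const r =>
    have : cfcHom hA (ContinuousMap.const _ r) = algebraMap ℝ (E →L[ℂ] E) r :=
      AlgHomClass.commutes (cfcHom hA) r
    rw [this, Algebra.algebraMap_eq_smul_one]
    simp
  | id => rw [cfcHom_id hA, h]; rfl
  | star_id => rw [star_trivial, cfcHom_id hA, h]; rfl
  | add f g hf hg => rw [map_add, add_apply, hf, hg]; simp [add_smul]
  | mul f g hf hg =>
    rw [map_mul, mul_apply_eq_comp, hg, map_smul, hf, smul_smul, mul_comm]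
    simp
  | frequently f hf =>
    have hc : IsClosed {g : C(spectrum ℝ A, ℝ) |
        (cfcHom hA g) e = ((g ⟨a, ha⟩ : ℝ) : ℂ) • e} := by
      refine isClosed_eq ?_ ?_
      · exact (ContinuousLinearMap.apply ℂ E e).continuous.comp (cfcHom_continuous hA)
      · exact (Complex.continuous_ofReal.comp (continuous_eval_const _)).smul continuous_const
    exact hc.mem_of_frequently_of_tendsto hf tendsto_id

theorem mem_spectrum_of_eigenvector {A : E →L[ℂ] E} {e : E} (he : e ≠ 0) {a : ℝ}
    (h : A e = (a : ℂ) • e) : a ∈ spectrum ℝ A := by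
  intro hu
  obtain ⟨u, hu⟩ := hu
  have h1 : (u : E →L[ℂ] E) e = 0 := by
    rw [hu, Algebra.algebraMap_eq_smul_one]
    simp [h]
  have h2 : ((u⁻¹ : (E →L[ℂ] E)ˣ) * (u : E →L[ℂ] E)) e = 0 := by
    rw [mul_apply_eq_comp, h1, map_zero]
  rw [Units.inv_mul] at h2
  exact he h2

theorem cfc_apply_eigenvector {A : E →L[ℂ] E} (hA : IsSelfAdjoint A) {e : E} {a : ℝ}
    (h : A e = (a : ℂ) • e) {f : ℝ → ℝ} (hf : Continuous f) :
    (cfc f A) e = ((f a : ℝ) : ℂ) • e := by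
  rcases eq_or_ne e 0 with rfl | he
  · simp
  have ha := mem_spectrum_of_eigenvector he h
  rw [cfc_apply f A hA hf.continuousOn, cfcHom_apply_eigenvector hA ha h]
  rfl

theorem rpow_eq_cfc {A : E →L[ℂ] E} (hA : 0 ≤ A) (t : ℝ) :
    A ^ t = cfc (fun x : ℝ => x ^ t) A := CFC.rpow_eq_cfc_real hA

theorem rpow_apply_eigenvector {A : E →L[ℂ] E} (hA : 0 ≤ A) {e : E} {a : ℝ}
    (h : A e = (a : ℂ) • e) {t : ℝ} (ht : 0 < t) :
    (A ^ t) e = ((a ^ t : ℝ) : ℂ) • e := by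
  rw [rpow_eq_cfc hA]
  exact cfc_apply_eigenvector (IsSelfAdjoint.of_nonneg hA) h
    (f := fun x => x ^ t) (Real.continuous_rpow_const ht.le)

theorem spectrum_nonneg {A : E →L[ℂ] E} (hA : 0 ≤ A) {x : ℝ} (hx : x ∈ spectrum ℝ A) : 0 ≤ x :=
  spectrum_nonneg_of_nonneg hA hx

/-! ### Jensen inequalities for powers in a unit vector. -/

theorem rpow_tangent_le {x c t : ℝ} (hx : 0 ≤ x) (hc : 0 < c) (ht : 1 ≤ t) :
    c ^ t + t * c ^ (t - 1) * (x - c) ≤ x ^ t := by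
  have h1 := one_add_mul_self_le_rpow_one_add (s := x / c - 1)
    (by have := div_nonneg hx hc.le; linarith) ht
  have h2 : (1 + (x / c - 1)) = x / c := by ring
  rw [h2, Real.div_rpow hx hc.le, le_div_iff₀ (by positivity)] at h1
  rw [Real.rpow_sub_one hc.ne']
  calc _ = (1 + t * (x / c - 1)) * c ^ t := by field_simp
    _ ≤ _ := h1

theorem le_rpow_tangent {x c t : ℝ} (hx : 0 ≤ x) (hc : 0 < c) (ht0 : 0 ≤ t) (ht : t ≤ 1) :
    x ^ t ≤ c ^ t + t * c ^ (t - 1) * (x - c) := by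
  have h1 := rpow_one_add_le_one_add_mul_self (s := x / c - 1)
    (by have := div_nonneg hx hc.le; linarith) ht0 ht
  have h2 : (1 + (x / c - 1)) = x / c := by ring
  rw [h2, Real.div_rpow hx hc.le, div_le_iff₀ (by positivity)] at h1
  rw [Real.rpow_sub_one hc.ne']
  calc _ ≤ _ := h1
    _ = _ := by field_simp

theorem cfc_affine {A : E →L[ℂ] E} (hA : 0 ≤ A) (k m : ℝ) :
    cfc (fun x : ℝ => k + m * x) A = algebraMap ℝ (E →L[ℂ] E) k + m • A := by
  have hA' : IsSelfAdjoint A := IsSelfAdjoint.of_nonneg hA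
  rw [cfc_const_add k (fun x => m * x) A, cfc_const_mul_id m A]

/-- The tangent line to `x^t` at `c = quadForm A e` lies below the convex power; the functional
calculus carries this to operators, and the linear term vanishes in the vector `e`. -/
theorem quadForm_rpow_ge {A : E →L[ℂ] E} (hA : 0 ≤ A) {e : E} (he : ‖e‖ = 1) {t : ℝ}
    (ht : 1 ≤ t) : quadForm A e ^ t ≤ quadForm (A ^ t) e := by
  rcases (quadForm_nonneg hA e).eq_or_lt with h0 | hc
  · rw [← h0, Real.zero_rpow (by linarith)]
    exact quadForm_nonneg CFC.rpow_nonneg e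
  set c := quadForm A e
  have hle : cfc (fun x : ℝ => (c ^ t - t * c ^ (t - 1) * c) + t * c ^ (t - 1) * x) A ≤ A ^ t := by
    rw [rpow_eq_cfc hA]
    refine cfc_mono (fun x hx => ?_) (by fun_prop)
      (Real.continuous_rpow_const (by linarith)).continuousOn
    have := rpow_tangent_le (spectrum_nonneg hA hx) hc ht
    linarith
  have h2 := quadForm_mono hle e
  rw [cfc_affine hA, quadForm_add, quadForm_algebraMap, quadForm_real_smul, he] at h2
  change _ + t * c ^ (t - 1) * c ≤ _ at h2
  linarith

/-- The concave counterpart. There is no tangent at `c = 0`; in that case `A e = 0`, which forces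
`A^t e = 0`. -/
theorem quadForm_rpow_le {A : E →L[ℂ] E} (hA : 0 ≤ A) {e : E} (he : ‖e‖ = 1) {t : ℝ}
    (ht0 : 0 < t) (ht : t ≤ 1) : quadForm (A ^ t) e ≤ quadForm A e ^ t := by
  rcases (quadForm_nonneg hA e).eq_or_lt with h0 | hc
  · rw [← h0, Real.zero_rpow (by linarith)]
    have h1 := apply_eq_zero_of_quadForm_eq_zero hA h0.symm
    rw [← CFC.rpow_one A hA] at h1
    rw [quadForm, rpow_apply_eq_zero A one_pos ht0 h1]
    simp
  set c := quadForm A e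
  have hle : A ^ t ≤ cfc (fun x : ℝ => (c ^ t - t * c ^ (t - 1) * c) + t * c ^ (t - 1) * x) A := by
    rw [rpow_eq_cfc hA]
    refine cfc_mono (fun x hx => ?_)
      (Real.continuous_rpow_const (by linarith)).continuousOn (by fun_prop)
    have := le_rpow_tangent (spectrum_nonneg hA hx) hc ht0.le ht
    linarith
  have h2 := quadForm_mono hle e
  rw [cfc_affine hA, quadForm_add, quadForm_algebraMap, quadForm_real_smul, he] at h2
  change _ ≤ _ + t * c ^ (t - 1) * c at h2
  linarith

/-! ### Traces, orthonormal families and eigenbases -/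

theorem Tr_eq_tsum_quadForm {ι : Type*} (b : HilbertBasis ι ℂ E) {A : E →L[ℂ] E} (hA : 0 ≤ A) :
    Tr A = ∑' i, ENNReal.ofReal (quadForm A (b i)) := Tr_eq_tsum b hA

theorem exists_hilbertBasis_extending {ι : Type*} {f : ι → E} (hf : Orthonormal ℂ f) :
    ∃ (w : Set E) (b : HilbertBasis w ℂ E) (g : ι → w), Function.Injective g ∧
      (∀ i, b (g i) = f i) ∧ ∀ j, j ∉ Set.range g → ∀ i, ⟪f i, b j⟫_ℂ = 0 := by
  have hinj : Function.Injective f := hf.linearIndependent.injective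
  obtain ⟨w, b, hw, hb⟩ := hf.toSubtypeRange.exists_hilbertBasis_extension
  let g : ι → w := fun i => ⟨f i, hw ⟨i, rfl⟩⟩
  have hg : ∀ i, b (g i) = f i := fun i => by rw [hb]
  refine ⟨w, b, g, fun i j h => hinj (congrArg Subtype.val h), hg, fun j hj i => ?_⟩
  rw [← hg]
  exact b.orthonormal.2 fun h => hj ⟨i, h⟩

theorem tsum_quadForm_le_Tr {ι : Type*} {f : ι → E} (hf : Orthonormal ℂ f) {A : E →L[ℂ] E}
    (hA : 0 ≤ A) : ∑' i, ENNReal.ofReal (quadForm A (f i)) ≤ Tr A := by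
  obtain ⟨w, b, g, hinj, hg, -⟩ := exists_hilbertBasis_extending hf
  rw [Tr_eq_tsum_quadForm b hA]
  simp_rw [← hg]
  exact ENNReal.tsum_comp_le_tsum_of_injective hinj
    fun j => ENNReal.ofReal (quadForm A (b j))

/-- The eigenspaces of a compact symmetric operator are orthogonal and jointly total, so Hilbert
bases of the single eigenspaces glue to one of the whole space. -/
theorem exists_eigenbasis.{u} {E : Type u} [NormedAddCommGroup E] [InnerProductSpace ℂ E]
    [CompleteSpace E] {A : E →L[ℂ] E} (hA : 0 ≤ A) (hc : IsCompactOperator A) :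
    ∃ (ι : Type u) (b : HilbertBasis ι ℂ E) (a : ι → ℝ),
      (∀ i, 0 ≤ a i) ∧ ∀ i, A (b i) = (a i : ℂ) • b i := by
  have hS : (A : E →ₗ[ℂ] E).IsSymmetric := fun x y => inner_apply_of_nonneg hA x y
  let V : ℂ → Submodule ℂ E := fun μ => Module.End.eigenspace (A : Module.End ℂ E) μ
  have hclosed : ∀ μ, IsClosed (V μ : Set E) := by
    intro μ
    have : (V μ : Set E) = {x | A x = μ • x} := by
      ext x
      exact Module.End.mem_eigenspace_iff
    rw [this]
    exact isClosed_eq A.continuous (continuous_const_smul μ)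
  have hcomp : ∀ μ, CompleteSpace (V μ) := fun μ => (hclosed μ).completeSpace_coe
  choose w bb hbb using fun μ => exists_hilbertBasis ℂ (V μ)
  let v : (Σ μ, w μ) → E := fun i => bb i.1 i.2
  have hv : Orthonormal ℂ v :=
    hS.orthogonalFamily_eigenspaces.orthonormal_sigma_orthonormal fun μ => (bb μ).orthonormal
  have hbot : (Submodule.span ℂ (Set.range v))ᗮ = ⊥ := by
    rw [← A.orthogonalComplement_iSup_eigenspaces_eq_bot hc hS]
    refine le_antisymm ?_ ?_
    · rw [← Submodule.iInf_orthogonal]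
      refine le_iInf fun μ => ?_
      intro x hx y hy
      have h0 : ∀ i, ⟪x, (bb μ i : E)⟫_ℂ = 0 := fun i => by
        rw [← inner_conj_symm, (Submodule.mem_orthogonal _ _).1 hx _
          (Submodule.subset_span ⟨⟨μ, i⟩, rfl⟩), map_zero]
      have h1 := ((innerSL ℂ x).comp (V μ).subtypeL).hasSum ((bb μ).hasSum_repr ⟨y, hy⟩)
      have h2 : (fun i => ((innerSL ℂ x).comp (V μ).subtypeL)
          ((bb μ).repr ⟨y, hy⟩ i • bb μ i)) = fun _ => 0 := by
        funext i
        simp [h0]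
      have h3 : ⟪x, y⟫_ℂ = 0 := by
        rw [h2] at h1
        exact h1.unique hasSum_zero
      rw [← inner_conj_symm, h3, map_zero]
    · refine Submodule.orthogonal_le (Submodule.span_le.2 ?_)
      rintro _ ⟨⟨μ, i⟩, rfl⟩
      exact Submodule.mem_iSup_of_mem μ (bb μ i).2
  let b : HilbertBasis (Σ μ, w μ) ℂ E := HilbertBasis.mkOfOrthogonalEqBot hv hbot
  have hb : ⇑b = v := HilbertBasis.coe_mkOfOrthogonalEqBot hv hbot
  have heig : ∀ i, A (v i) = i.1 • v i := fun i =>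
    Module.End.mem_eigenspace_iff.1 (bb i.1 i.2).2
  have hin : ∀ i, ⟪v i, A (v i)⟫_ℂ = i.1 := fun i => by
    rw [heig, inner_smul_right, inner_self_eq_norm_sq_to_K, hv.1]
    simp
  -- The eigenvalue is indexed as a complex number; symmetry shows that it is real.
  have hre : ∀ i, ((quadForm A (v i) : ℝ) : ℂ) = i.1 := fun i => by
    have h1 := RCLike.conj_eq_iff_re.1
      ((inner_conj_symm (A (v i)) (v i)).trans (inner_apply_of_nonneg hA (v i) (v i)))
    rw [hin] at h1
    rw [quadForm, hin]
    exact h1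
  refine ⟨_, b, fun i => quadForm A (v i), fun i => quadForm_nonneg hA _, fun i => ?_⟩
  rw [hb, hre, heig]

theorem Tr_rpow_eq_tsum_eigenvalues {ι : Type*} (b : HilbertBasis ι ℂ E) {A : E →L[ℂ] E}
    (hA : 0 ≤ A) {a : ι → ℝ} (hb : ∀ i, A (b i) = (a i : ℂ) • b i) {t : ℝ} (ht : 0 < t) :
    Tr (A ^ t) = ∑' i, ENNReal.ofReal (a i ^ t) := by
  rw [Tr_eq_tsum_quadForm b CFC.rpow_nonneg]
  refine tsum_congr fun i => ?_
  rw [quadForm_of_eigenvector (rpow_apply_eigenvector hA (hb i) ht), b.orthonormal.1]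
  simp

/-! ### Operators with finite traces are compact -/

theorem isCompactOperator_of_finiteDimensional_range (A : E →L[ℂ] E)
    (h : FiniteDimensional ℂ (LinearMap.range (A : E →ₗ[ℂ] E))) : IsCompactOperator A := by
  let B : E →L[ℂ] LinearMap.range (A : E →ₗ[ℂ] E) := A.codRestrict _ fun x => ⟨x, rfl⟩
  have : ProperSpace (LinearMap.range (A : E →ₗ[ℂ] E)) := FiniteDimensional.proper ℂ _
  have hB : IsCompactOperator B := isCompactOperator_of_locallyCompactSpace_dom B
  exact hB.clm_comp (LinearMap.range (A : E →ₗ[ℂ] E)).subtypeL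

/-- The truncations `(A - c)₊` converge to `A` in norm as `c → 0`, so one of them has infinite rank.
Its range is the subspace `M`: there `A^t ≥ c^t` because `(x - c)₊` vanishes for `x ≤ c`. -/
theorem exists_submodule_of_not_isCompactOperator {A : E →L[ℂ] E} (hA : 0 ≤ A)
    (hc : ¬ IsCompactOperator A) :
    ∃ (c : ℝ) (M : Submodule ℂ E), 0 < c ∧ ¬ FiniteDimensional ℂ M ∧
      M ≤ (LinearMap.ker (A : E →ₗ[ℂ] E))ᗮ ∧
      ∀ t : ℝ, 0 < t → ∀ x ∈ M, c ^ t * ‖x‖ ^ 2 ≤ quadForm (A ^ t) x := by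
  have hA' : IsSelfAdjoint A := IsSelfAdjoint.of_nonneg hA
  let B : ℝ → (E →L[ℂ] E) := fun c => cfc (fun x : ℝ => max (x - c) 0) A
  have hBsa : ∀ c, IsSelfAdjoint (B c) := fun c => cfc_predicate _ _
  have hfin : ∃ c > 0, ¬ FiniteDimensional ℂ (LinearMap.range (B c : E →ₗ[ℂ] E)) := by
    by_contra! hfin
    refine hc (isCompactOperator_of_tendsto (l := atTop) (F := fun n : ℕ => B (1 / (n + 1))) ?_
      (Eventually.of_forall fun n =>
        isCompactOperator_of_finiteDimensional_range _ (hfin _ (by positivity))))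
    rw [tendsto_iff_norm_sub_tendsto_zero]
    refine squeeze_zero (fun n => norm_nonneg _) (fun n => ?_)
      (tendsto_one_div_add_atTop_nhds_zero_nat (𝕜 := ℝ))
    have h1 : B (1 / (n + 1)) - A =
        cfc (fun x : ℝ => max (x - 1 / (n + 1)) 0 - x) A := by
      rw [cfc_sub (fun x : ℝ => max (x - 1 / (n + 1)) 0) (fun x => x) A
        (by fun_prop) (by fun_prop), cfc_id' ℝ A]
    rw [h1]
    have hp : (0 : ℝ) < 1 / (n + 1) := by positivity
    refine norm_cfc_le hp.le fun x hx => ?_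
    have hx0 := spectrum_nonneg hA hx
    rw [Real.norm_eq_abs, abs_le]
    rcases max_cases (x - 1 / ((n : ℝ) + 1)) 0 with ⟨h, h'⟩ | ⟨h, h'⟩ <;> rw [h] <;>
      constructor <;> linarith
  obtain ⟨c, hc0, hfin⟩ := hfin
  refine ⟨c, _, hc0, hfin, ?_, ?_⟩
  · rintro _ ⟨x, rfl⟩
    rw [Submodule.mem_orthogonal]
    intro k hk
    have hk' : A k = ((0 : ℝ) : ℂ) • k := by
      rw [Complex.ofReal_zero, zero_smul]
      exact hk
    have h1 : B c k = 0 := by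
      have := cfc_apply_eigenvector hA' hk' (f := fun x => max (x - c) 0) (by fun_prop)
      rw [this]
      simp [hc0.le]
    have h2 := inner_star_apply (B c) k x
    rw [(hBsa c).star_eq, h1, inner_zero_left] at h2
    exact h2
  · rintro t ht _ ⟨x, rfl⟩
    have hcont : Continuous fun x : ℝ => x ^ t := Real.continuous_rpow_const ht.le
    have h1 : star (B c) * (algebraMap ℝ (E →L[ℂ] E) (c ^ t)) * B c ≤ star (B c) * A ^ t * B c := by
      have e : ∀ g : ℝ → ℝ, Continuous g → star (B c) * cfc g A * B c =
          cfc (fun x => max (x - c) 0 * g x * max (x - c) 0) A := fun g hg => by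
        rw [(hBsa c).star_eq, cfc_mul (fun x => max (x - c) 0 * g x) (fun x => max (x - c) 0) A
          (by fun_prop) (by fun_prop), cfc_mul (fun x => max (x - c) 0) g A (by fun_prop)
          (by fun_prop)]
      rw [rpow_eq_cfc hA, ← cfc_const (c ^ t) A, e _ continuous_const, e _ hcont]
      refine cfc_mono (fun x hx => ?_) (by fun_prop)
        (((Continuous.mul (by fun_prop) hcont).mul (by fun_prop)).continuousOn)
      rcases max_cases (x - c) 0 with ⟨h, h'⟩ | ⟨h, h'⟩
      · have : c ^ t ≤ x ^ t := Real.rpow_le_rpow hc0.le (by linarith) ht.le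
        have h0 : 0 ≤ max (x - c) 0 := le_max_right _ _
        gcongr
      · simp [h]
    have h2 := quadForm_mono h1 x
    rw [quadForm_star_mul_mul, quadForm_star_mul_mul, quadForm_algebraMap] at h2
    exact h2

theorem exists_orthonormal_nat (M : Submodule ℂ E) (hM : ¬ FiniteDimensional ℂ M) :
    ∃ e : ℕ → E, Orthonormal ℂ e ∧ ∀ i, e i ∈ M := by
  have hinf : Infinite (Module.Basis.ofVectorSpaceIndex ℂ M) := by
    by_contra hfin
    rw [not_infinite_iff_finite] at hfin
    exact hM (Module.Finite.of_basis (Module.Basis.ofVectorSpace ℂ M))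
  let f : ℕ → M := fun n => Module.Basis.ofVectorSpace ℂ M (Infinite.natEmbedding _ n)
  have hf : LinearIndependent ℂ f :=
    (Module.Basis.ofVectorSpace ℂ M).linearIndependent.comp _ (Infinite.natEmbedding _).injective
  have hg := InnerProductSpace.gramSchmidtNormed_orthonormal hf
  exact ⟨fun n => (InnerProductSpace.gramSchmidtNormed ℂ f n : M),
    hg.comp_linearIsometry M.subtypeₗᵢ, fun i => Subtype.coe_prop _⟩

/-- Otherwise an infinite orthonormal sequence would contribute at least `c^t > 0` per vector to the
trace. -/
theorem isCompactOperator_of_Tr_rpow_lt_top {A : E →L[ℂ] E} (hA : 0 ≤ A) {t : ℝ} (ht : 0 < t)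
    (h : Tr (A ^ t) < ∞) : IsCompactOperator A := by
  by_contra hc
  obtain ⟨c, M, hc0, hM, -, hq⟩ := exists_submodule_of_not_isCompactOperator hA hc
  obtain ⟨e, he, heM⟩ := exists_orthonormal_nat M hM
  refine h.ne (top_unique ?_)
  calc (⊤ : ℝ≥0∞) = ∑' _ : ℕ, ENNReal.ofReal (c ^ t) := by
        rw [ENNReal.tsum_const_eq_top_of_ne_zero]
        simpa using Real.rpow_pos_of_pos hc0 t
    _ ≤ ∑' i, ENNReal.ofReal (quadForm (A ^ t) (e i)) := by
        refine ENNReal.tsum_le_tsum fun i => ENNReal.ofReal_le_ofReal ?_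
        have := hq t ht _ (heM i)
        rwa [he.1, one_pow, mul_one] at this
    _ ≤ Tr (A ^ t) := tsum_quadForm_le_Tr he CFC.rpow_nonneg

/-! ### Normalized images of eigenvectors and `Tr (X* X)^t = Tr (X X*)^t` -/

theorem inner_apply_apply (C : E →L[ℂ] E) (x y : E) : ⟪C x, C y⟫_ℂ = ⟪x, (star C * C) y⟫_ℂ := by
  rw [mul_apply_eq_comp, inner_star_apply]

/-- Half of the singular value decomposition: the vectors `C (b i)` are orthogonal with norms `√(a
i)`, and those with `a i = 0` are dropped. -/
theorem orthonormal_normalized {ι : Type*} {b : ι → E} (hb : Orthonormal ℂ b) {C : E →L[ℂ] E}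
    {a : ι → ℝ} (h : ∀ i, (star C * C) (b i) = (a i : ℂ) • b i) :
    Orthonormal ℂ fun i : {i // 0 < a i} => (((√(a i))⁻¹ : ℝ) : ℂ) • C (b i) := by
  classical
  rw [orthonormal_iff_ite]
  intro i j
  rw [inner_smul_left, inner_smul_right, inner_apply_apply, h, inner_smul_right,
    orthonormal_iff_ite.1 hb]
  rcases eq_or_ne i j with rfl | hij
  · have h1 : (√(a i))⁻¹ * ((√(a i))⁻¹ * a i) = 1 := by
      have h2 : √(a i) ≠ 0 := (Real.sqrt_pos.2 i.2).ne'
      nth_rewrite 3 [← Real.mul_self_sqrt i.2.le]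
      field_simp
    simp only [if_true, mul_one, Complex.conj_ofReal]
    exact_mod_cast h1
  · simp [hij, Subtype.val_injective.ne hij]

theorem tsum_eq_tsum_pos {ι : Type*} {a : ι → ℝ} (ha : ∀ i, 0 ≤ a i) {g : ι → ℝ≥0∞}
    (hg : ∀ i, a i = 0 → g i = 0) : ∑' i, g i = ∑' i : {i // 0 < a i}, g i := by
  refine (tsum_subtype_eq_of_support_subset (s := {i | 0 < a i}) fun i hi => ?_).symm
  exact lt_of_le_of_ne (ha i) fun h => hi (hg i h.symm)

/-- The normalized `X (b i)` are eigenvectors of `X X*` with the same eigenvalues. They need not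
form a basis, hence only an inequality; exchanging `X` and `X*` gives the other one. -/
theorem Tr_rpow_star_mul_self_le {X : E →L[ℂ] E} (hc : IsCompactOperator (star X * X))
    {t : ℝ} (ht : 0 < t) : Tr ((star X * X) ^ t) ≤ Tr ((X * star X) ^ t) := by
  obtain ⟨ι, b, a, ha, hb⟩ := exists_eigenbasis (star_mul_self_nonneg X) hc
  have hf := orthonormal_normalized b.orthonormal hb
  refine le_trans (le_of_eq ?_) (tsum_quadForm_le_Tr hf CFC.rpow_nonneg)
  rw [Tr_rpow_eq_tsum_eigenvalues b (star_mul_self_nonneg X) hb ht,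
    tsum_eq_tsum_pos ha fun i hi => by rw [hi, Real.zero_rpow ht.ne', ENNReal.ofReal_zero]]
  refine tsum_congr fun i => ?_
  have heig : (X * star X) ((((√(a i))⁻¹ : ℝ) : ℂ) • X (b i)) =
      (a i : ℂ) • ((((√(a i))⁻¹ : ℝ) : ℂ) • X (b i)) := by
    have h1 : (X * star X) (X (b i)) = X ((star X * X) (b i)) := rfl
    rw [map_smul, h1, hb, map_smul, smul_comm]
  rw [quadForm_of_eigenvector (rpow_apply_eigenvector (mul_star_self_nonneg X) heig ht), hf.1 i]
  simp

theorem Tr_rpow_star_mul_self_eq {X : E →L[ℂ] E} (hc : IsCompactOperator (star X * X))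
    (hc' : IsCompactOperator (X * star X)) {t : ℝ} (ht : 0 < t) :
    Tr ((star X * X) ^ t) = Tr ((X * star X) ^ t) := by
  refine le_antisymm (Tr_rpow_star_mul_self_le hc ht) ?_
  have := Tr_rpow_star_mul_self_le (X := star X) (by rwa [star_star]) ht
  rwa [star_star] at this

/-! ### Hölder's inequality -/

theorem inner_le_Lp_mul_Lq_tsum {ι : Type*} (f g : ι → ℝ≥0∞) {p q : ℝ}
    (hpq : p.HolderConjugate q) :
    ∑' i, f i * g i ≤ (∑' i, f i ^ p) ^ (1 / p) * (∑' i, g i ^ q) ^ (1 / q) := by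
  rw [ENNReal.tsum_eq_iSup_sum]
  refine iSup_le fun s => (ENNReal.inner_le_Lp_mul_Lq s f g hpq).trans ?_
  have := hpq.pos
  have := hpq.symm.pos
  gcongr <;> exact ENNReal.sum_le_tsum s

/-- The exponents `z/w` and `u/w` are conjugate, so this is the usual Hölder inequality for the
sequences `g^w` and `h^w`. -/
theorem tsum_rpow_le_of_le_mul {ι : Type*} {a g h : ι → ℝ} (ha : ∀ i, 0 ≤ a i)
    (hg : ∀ i, 0 ≤ g i) (hh : ∀ i, 0 ≤ h i) (hle : ∀ i, a i ≤ g i * h i) {w z u : ℝ}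
    (hw : 0 < w) (hz : 0 < z) (hu : 0 < u) (hwzu : 1 / w = 1 / z + 1 / u) :
    ∑' i, ENNReal.ofReal (a i ^ w) ≤ (∑' i, ENNReal.ofReal (g i ^ z)) ^ (w / z) *
      (∑' i, ENNReal.ofReal (h i ^ u)) ^ (w / u) := by
  have hpq : (z / w).HolderConjugate (u / w) := by
    rw [Real.holderConjugate_iff]
    have hw' : w < z := by
      rw [← one_div_lt_one_div hz hw, hwzu]
      exact lt_add_of_pos_right _ (by positivity)
    refine ⟨(one_lt_div hw).2 hw', ?_⟩
    rw [inv_div, inv_div, div_eq_mul_one_div w z, div_eq_mul_one_div w u, ← mul_add, ← hwzu,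
      mul_one_div_cancel hw.ne']
  have h1 := inner_le_Lp_mul_Lq_tsum (fun i => ENNReal.ofReal (g i ^ w))
    (fun i => ENNReal.ofReal (h i ^ w)) hpq
  have e1 : ∀ i, ENNReal.ofReal (g i ^ w) ^ (z / w) = ENNReal.ofReal (g i ^ z) := fun i => by
    rw [ENNReal.ofReal_rpow_of_nonneg (Real.rpow_nonneg (hg i) _) (by positivity),
      ← Real.rpow_mul (hg i), mul_div_cancel₀ _ hw.ne']
  have e2 : ∀ i, ENNReal.ofReal (h i ^ w) ^ (u / w) = ENNReal.ofReal (h i ^ u) := fun i => by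
    rw [ENNReal.ofReal_rpow_of_nonneg (Real.rpow_nonneg (hh i) _) (by positivity),
      ← Real.rpow_mul (hh i), mul_div_cancel₀ _ hw.ne']
  simp only [e1, e2, one_div_div] at h1
  refine le_trans (ENNReal.tsum_le_tsum fun i => ?_) h1
  rw [← ENNReal.ofReal_mul (Real.rpow_nonneg (hg i) _), ← Real.mul_rpow (hg i) (hh i)]
  exact ENNReal.ofReal_le_ofReal (Real.rpow_le_rpow (ha i) (hle i) hw.le)

theorem tsum_quadForm_rpow_le {ι : Type*} {f : ι → E} (hf : Orthonormal ℂ f) {A : E →L[ℂ] E}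
    (hA : 0 ≤ A) {t : ℝ} (ht : 1 ≤ t) :
    ∑' i, ENNReal.ofReal (quadForm A (f i) ^ t) ≤ Tr (A ^ t) :=
  (ENNReal.tsum_le_tsum fun i => ENNReal.ofReal_le_ofReal
    (quadForm_rpow_ge hA (hf.1 i) ht)).trans (tsum_quadForm_le_Tr hf CFC.rpow_nonneg)

theorem star_mul_mul_nonneg (Y : E →L[ℂ] E) {R : E →L[ℂ] E} (hR : 0 ≤ R) : 0 ≤ star Y * R * Y :=
  star_left_conjugate_nonneg hR Y

/-- Since `‖C x‖² ≤ ‖x‖ ‖C* C x‖`, total boundedness of the image of the ball under `C* C` passes to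
the image under `C`. -/
theorem isCompactOperator_of_star_mul_self {C : E →L[ℂ] E}
    (h : IsCompactOperator (star C * C)) : IsCompactOperator C := by
  change IsCompactOperator (C : E →ₗ[ℂ] E)
  rw [isCompactOperator_iff_isCompact_closure_image_ball (C : E →ₗ[ℂ] E) one_pos]
  refine TotallyBounded.isCompact_of_isClosed (TotallyBounded.closure ?_) isClosed_closure
  rw [Metric.totallyBounded_iff]
  intro ε hε
  have htb : TotallyBounded ((star C * C) '' Metric.ball 0 1) :=
    ((isCompactOperator_iff_isCompact_closure_image_ball
      ((star C * C : E →L[ℂ] E) : E →ₗ[ℂ] E) one_pos).1 h).totallyBounded.subset subset_closure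
  -- Differences of points of the unit ball have norm at most `2`, and `2 · ε²/2 = ε²`.
  obtain ⟨t, hts, htf, ht⟩ := Metric.finite_approx_of_totallyBounded htb (ε ^ 2 / 2) (by positivity)
  have hts' : ∀ y ∈ t, ∃ x ∈ Metric.ball (0 : E) 1, (star C * C) x = y := fun y hy => hts hy
  choose! g hgb hg using hts'
  refine ⟨(fun y => C (g y)) '' t, htf.image _, ?_⟩
  rintro _ ⟨x, hx, rfl⟩
  obtain ⟨y, hy, hxy⟩ := Set.mem_iUnion₂.1 (ht ⟨x, hx, rfl⟩)
  refine Set.mem_iUnion₂.2 ⟨_, ⟨y, hy, rfl⟩, ?_⟩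
  rw [Metric.mem_ball, dist_eq_norm] at hxy ⊢
  rw [← hg y hy, ← map_sub] at hxy
  have h0 := hgb y hy
  rw [mem_ball_zero_iff] at hx h0
  have h1 : ‖C (x - g y)‖ ^ 2 ≤ ‖x - g y‖ * ‖(star C * C) (x - g y)‖ := by
    rw [← quadForm_star_mul_self]
    exact (RCLike.re_le_norm _).trans (norm_inner_le_norm _ _)
  have h2 : ‖x - g y‖ ≤ 2 := (norm_sub_le _ _).trans (by linarith)
  change ‖C x - C (g y)‖ < ε
  rw [← map_sub]
  refine lt_of_pow_lt_pow_left₀ 2 hε.le ?_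
  nlinarith [norm_nonneg (x - g y), norm_nonneg ((star C * C) (x - g y))]

/-- Cauchy-Schwarz applied to `s = ⟨R^(1/2) f, Y x⟩`. -/
theorem sq_le_quadForm_mul_quadForm {R Y : E →L[ℂ] E} (hR : 0 ≤ R) {x f : E} {s : ℝ} (hs : 0 < s)
    (hf : ‖f‖ = 1) (h : (R ^ (1 / 2 : ℝ) * Y) x = (s : ℂ) • f) :
    s ^ 2 ≤ quadForm R f * quadForm (star Y * Y) x := by
  have h1 : s = RCLike.re ⟪(R ^ (1 / 2 : ℝ)) f, Y x⟫_ℂ := by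
    have h' : (R ^ (1 / 2 : ℝ)) (Y x) = (s : ℂ) • f := h
    rw [inner_apply_of_nonneg (CFC.rpow_nonneg (a := R) (y := 1 / 2)), h', inner_smul_right,
      inner_self_eq_norm_sq_to_K, hf]
    simp
  have h2 : s ≤ ‖(R ^ (1 / 2 : ℝ)) f‖ * ‖Y x‖ :=
    h1.le.trans ((RCLike.re_le_norm _).trans (norm_inner_le_norm _ _))
  rw [quadForm_eq_norm_sq hR, quadForm_star_mul_self, ← mul_pow]
  exact pow_le_pow_left₀ hs.le h2 2

/-- For `u ≥ 1`, an eigenbasis of `Y* R Y` is used: each eigenvalue is at most a value of `quadForm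
R` times one of `quadForm (Y* Y)`, and after scalar Hölder convex Jensen bounds both sums by traces.
For `u ≤ 1`, where Jensen for `Y* Y` points the wrong way, an eigenbasis of `Y* Y` makes that sum
exact, and `w ≤ u ≤ 1` allows concave Jensen for `Y* R Y`. -/
theorem Tr_rpow_conj_le_of_one_le {R Y : E →L[ℂ] E} (hR : 0 ≤ R) {w z u : ℝ}
    (hw : 0 < w) (hz : 1 ≤ z) (hu : 0 < u) (hwzu : 1 / w = 1 / z + 1 / u)
    (hY : Tr ((star Y * Y) ^ u) < ∞) :
    Tr ((star Y * R * Y) ^ w) ≤ Tr (R ^ z) ^ (w / z) * Tr ((star Y * Y) ^ u) ^ (w / u) := by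
  have hz0 : 0 < z := by linarith
  have hYYc := isCompactOperator_of_Tr_rpow_lt_top (star_mul_self_nonneg Y) hu hY
  have hYc := isCompactOperator_of_star_mul_self hYYc
  have hRY := star_mul_mul_nonneg Y hR
  rcases le_total 1 u with h1u | hu1
  · have hc : IsCompactOperator (star Y * R * Y) := hYc.clm_comp (star Y * R)
    obtain ⟨ι, b, a, ha, hb⟩ := exists_eigenbasis hRY hc
    have hX : star Y * R * Y = star (R ^ (1 / 2 : ℝ) * Y) * (R ^ (1 / 2 : ℝ) * Y) := by
      rw [star_mul, star_rpow, mul_assoc, mul_assoc, ← mul_assoc (R ^ (1 / 2 : ℝ)), sqrt_mul_sqrt hR]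
    rw [hX] at hb
    have hf := orthonormal_normalized b.orthonormal hb
    rw [← hX] at hb
    rw [Tr_rpow_eq_tsum_eigenvalues b hRY hb hw,
      tsum_eq_tsum_pos ha fun i hi => by rw [hi, Real.zero_rpow hw.ne', ENNReal.ofReal_zero]]
    refine (tsum_rpow_le_of_le_mul (ι := {i // 0 < a i}) (fun i => ha i) (fun i => quadForm_nonneg hR _)
      (fun i => quadForm_nonneg (star_mul_self_nonneg Y) _) (fun i => ?_) hw hz0 hu hwzu).trans
      (mul_le_mul' (ENNReal.rpow_le_rpow (tsum_quadForm_rpow_le hf hR hz) (by positivity))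
        (ENNReal.rpow_le_rpow (tsum_quadForm_rpow_le
          (b.orthonormal.comp _ Subtype.val_injective) (star_mul_self_nonneg Y) h1u)
          (by positivity)))
    have hs := Real.sqrt_pos.2 i.2
    refine (Real.sq_sqrt i.2.le).symm.le.trans (sq_le_quadForm_mul_quadForm hR hs (hf.1 i) ?_)
    rw [smul_smul, ← Complex.ofReal_mul, mul_inv_cancel₀ hs.ne', Complex.ofReal_one, one_smul]
    rfl
  · obtain ⟨ι, b, a, ha, hb⟩ := exists_eigenbasis (star_mul_self_nonneg Y) hYYc
    have hf := orthonormal_normalized b.orthonormal hb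
    have hw1 : w ≤ 1 := by
      refine le_trans ?_ hu1
      rw [← one_div_le_one_div hu hw, hwzu]
      exact le_add_of_nonneg_left (by positivity)
    have hq : ∀ i : {i // 0 < a i}, quadForm (star Y * R * Y) (b i) =
        quadForm R ((((√(a i))⁻¹ : ℝ) : ℂ) • Y (b i)) * a i := fun i => by
      rw [quadForm_star_mul_mul, quadForm_smul, Complex.norm_real, Real.norm_of_nonneg
        (by positivity), inv_pow, Real.sq_sqrt i.2.le]
      field_simp [i.2.ne']
    have h1 : Tr ((star Y * R * Y) ^ w) ≤
        ∑' i, ENNReal.ofReal (quadForm (star Y * R * Y) (b i) ^ w) := by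
      rw [Tr_eq_tsum_quadForm b CFC.rpow_nonneg]
      exact ENNReal.tsum_le_tsum fun i => ENNReal.ofReal_le_ofReal
        (quadForm_rpow_le hRY (b.orthonormal.1 i) hw hw1)
    refine h1.trans ?_
    rw [tsum_eq_tsum_pos ha fun i hi => by
      have h2 := quadForm_of_eigenvector (hb i)
      rw [hi, zero_mul, quadForm_star_mul_self, sq_eq_zero_iff, norm_eq_zero] at h2
      simp [h2, quadForm, hw.ne'],
      Tr_rpow_eq_tsum_eigenvalues b (star_mul_self_nonneg Y) hb hu,
      tsum_eq_tsum_pos (g := fun i => ENNReal.ofReal (a i ^ u)) ha fun i hi => by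
        rw [hi, Real.zero_rpow hu.ne', ENNReal.ofReal_zero]]
    exact (tsum_rpow_le_of_le_mul (ι := {i // 0 < a i}) (fun i => quadForm_nonneg hRY _) (fun i => quadForm_nonneg hR _)
      (fun i => ha i) (fun i => (hq i).le) hw hz0 hu hwzu).trans
      (mul_le_mul' (ENNReal.rpow_le_rpow (tsum_quadForm_rpow_le hf hR hz) (by positivity)) le_rfl)

/-- Small `z` is reached by doubling. With `X = R^(1/2)` one has `X^(2z) = R^z`, and `Y' = X^(1/2)
Y` satisfies `Y'* Y' = Y* X Y` and `Y'* X Y' = Y* R Y`; two applications of the bound for `X` with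
exponent `2z` give the one for `R`. -/
theorem Tr_rpow_conj_le_of_pow_le (n : ℕ) : ∀ {R Y : E →L[ℂ] E}, 0 ≤ R → ∀ {w z u : ℝ},
    0 < w → (1 / 2) ^ n ≤ z → 0 < u → 1 / w = 1 / z + 1 / u → Tr (R ^ z) < ∞ →
    Tr ((star Y * Y) ^ u) < ∞ →
    Tr ((star Y * R * Y) ^ w) ≤ Tr (R ^ z) ^ (w / z) * Tr ((star Y * Y) ^ u) ^ (w / u) := by
  induction n with
  | zero =>
    intro R Y hR w z u hw hz hu hwzu _ hY
    exact Tr_rpow_conj_le_of_one_le hR hw (by simpa using hz) hu hwzu hY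
  | succ n ih =>
    intro R Y hR w z u hw hz hu hwzu hRz hY
    have hz0 : 0 < z := lt_of_lt_of_le (by positivity) hz
    have hz2 : (1 / 2) ^ n ≤ 2 * z := by
      rw [pow_succ] at hz
      linarith
    set X : E →L[ℂ] E := R ^ (1 / 2 : ℝ) with hX
    have hX0 : 0 ≤ X := CFC.rpow_nonneg
    have hXz : X ^ (2 * z) = R ^ z := by
      rw [hX, CFC.rpow_rpow_of_exponent_nonneg R (1 / 2) (2 * z) (by norm_num) (by positivity) hR]
      congr 1
      ring
    set Y' : E →L[ℂ] E := X ^ (1 / 2 : ℝ) * Y with hY'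
    have hXX : X ^ (1 / 2 : ℝ) * X ^ (1 / 2 : ℝ) = X := sqrt_mul_sqrt hX0
    have e1 : star Y' * Y' = star Y * X * Y := by
      rw [hY', star_mul, star_rpow]
      calc _ = star Y * (X ^ (1 / 2 : ℝ) * X ^ (1 / 2 : ℝ)) * Y := by simp only [mul_assoc]
        _ = _ := by rw [hXX]
    have e2 : star Y' * X * Y' = star Y * R * Y := by
      rw [hY', star_mul, star_rpow, ← sqrt_mul_sqrt hR, ← hX]
      calc _ = star Y * (X ^ (1 / 2 : ℝ) * X * X ^ (1 / 2 : ℝ)) * Y := by simp only [mul_assoc]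
        _ = star Y * (X ^ (1 / 2 : ℝ) * (X ^ (1 / 2 : ℝ) * X ^ (1 / 2 : ℝ)) * X ^ (1 / 2 : ℝ)) * Y
          := by rw [hXX]
        _ = star Y * ((X ^ (1 / 2 : ℝ) * X ^ (1 / 2 : ℝ)) * (X ^ (1 / 2 : ℝ) * X ^ (1 / 2 : ℝ))) * Y
          := by simp only [mul_assoc]
        _ = _ := by rw [hXX]
    -- The exponent of the intermediate operator `Y* X Y`, so that `1/w = 1/(2z) + 1/u'`.
    obtain ⟨u', hu', hu'eq⟩ : ∃ u' : ℝ, 0 < u' ∧ 1 / u' = 1 / (2 * z) + 1 / u :=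
      ⟨1 / (1 / (2 * z) + 1 / u), by positivity, one_div_one_div _⟩
    have hw' : 1 / w = 1 / (2 * z) + 1 / u' := by
      rw [hwzu, hu'eq]
      field_simp
      ring
    have h1 := ih (Y := Y) hX0 hu' hz2 hu hu'eq (by rwa [hXz]) hY
    rw [hXz] at h1
    have hfin : Tr ((star Y' * Y') ^ u') < ∞ := by
      rw [e1]
      refine h1.trans_lt (ENNReal.mul_lt_top ?_ ?_)
      · exact ENNReal.rpow_lt_top_of_nonneg (by positivity) hRz.ne
      · exact ENNReal.rpow_lt_top_of_nonneg (by positivity) hY.ne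
    have h2 := ih (Y := Y') hX0 hw hz2 hu' hw' (by rwa [hXz]) hfin
    rw [e2, hXz, e1] at h2
    refine h2.trans ((mul_le_mul' le_rfl (ENNReal.rpow_le_rpow h1 (by positivity))).trans
      (le_of_eq ?_))
    rw [ENNReal.mul_rpow_of_nonneg _ _ (by positivity), ← ENNReal.rpow_mul, ← ENNReal.rpow_mul,
      ← mul_assoc, ← ENNReal.rpow_add_of_nonneg _ _ (by positivity) (by positivity)]
    congr 2
    · field_simp
      ring
    · field_simp

/-- **Hölder's inequality** for `Tr |R^{1/2} Y|^{2w}`, with arbitrary positive exponents. -/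
theorem Tr_rpow_conj_le {R Y : E →L[ℂ] E} (hR : 0 ≤ R) {w z u : ℝ}
    (hw : 0 < w) (hz : 0 < z) (hu : 0 < u) (hwzu : 1 / w = 1 / z + 1 / u)
    (hRz : Tr (R ^ z) < ∞) (hY : Tr ((star Y * Y) ^ u) < ∞) :
    Tr ((star Y * R * Y) ^ w) ≤ Tr (R ^ z) ^ (w / z) * Tr ((star Y * Y) ^ u) ^ (w / u) := by
  obtain ⟨n, hn⟩ := exists_pow_lt_of_lt_one hz (by norm_num : (1 / 2 : ℝ) < 1)
  exact Tr_rpow_conj_le_of_pow_le n hR hw hn.le hu hwzu hRz hY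

/-! ### Finite-rank operators -/

theorem isCompactOperator_mul_of_right (A : E →L[ℂ] E) {B : E →L[ℂ] E}
    (hB : IsCompactOperator B) : IsCompactOperator (A * B) := by
  have h : IsCompactOperator (A ∘ B) := hB.clm_comp A
  exact h

theorem isCompactOperator_mul_of_left {A : E →L[ℂ] E} (hA : IsCompactOperator A)
    (B : E →L[ℂ] E) : IsCompactOperator (A * B) := by
  have h : IsCompactOperator (A ∘ B) := hA.comp_clm B
  exact h

theorem Tr_rpow_star_mul_self_congr {X Y : E →L[ℂ] E} (hX : IsCompactOperator X)
    (hY : IsCompactOperator Y) (h : X * star X = Y * star Y) {t : ℝ} (ht : 0 < t) :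
    Tr ((star X * X) ^ t) = Tr ((star Y * Y) ^ t) := by
  have h1 := Tr_rpow_star_mul_self_eq (isCompactOperator_mul_of_right (star X) hX)
    (isCompactOperator_mul_of_left hX (star X)) ht
  have h2 := Tr_rpow_star_mul_self_eq (isCompactOperator_mul_of_right (star Y) hY)
    (isCompactOperator_mul_of_left hY (star Y)) ht
  rw [h1, h2, h]

theorem Tr_rpow_conj_eq_of_mul_star_eq {B K Z : E →L[ℂ] E} (hB : 0 ≤ B)
    (hK : IsCompactOperator K) (hZ : IsCompactOperator Z) (h : K * star K = Z * star Z) {t : ℝ}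
    (ht : 0 < t) : Tr ((star K * B * K) ^ t) = Tr ((star Z * B * Z) ^ t) := by
  obtain ⟨C, hC, hCC⟩ : ∃ C : E →L[ℂ] E, star C = C ∧ C * C = B :=
    ⟨B ^ (1 / 2 : ℝ), star_rpow _ _, sqrt_mul_sqrt hB⟩
  have e : ∀ W : E →L[ℂ] E, star (C * W) * (C * W) = star W * B * W := fun W => by
    rw [star_mul, hC, ← hCC]
    simp only [mul_assoc]
  have e' : ∀ W : E →L[ℂ] E, (C * W) * star (C * W) = C * (W * star W) * C := fun W => by
    rw [star_mul, hC]
    simp only [mul_assoc]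
  have := Tr_rpow_star_mul_self_congr (isCompactOperator_mul_of_right C hK)
    (isCompactOperator_mul_of_right C hZ) (X := C * K) (Y := C * Z) (by rw [e', e', h]) ht
  rwa [e, e] at this

/-- `K = (Z Z*)^(1/2)` satisfies `K K* = Z Z*`, and the trace depends on `K` only through `K K*`.
This removes the square root of `H` from the test operators. -/
theorem trConj_mul_star {Z : E →L[ℂ] E} (hZ : IsCompactOperator Z) (A : E →L[ℂ] E) {p : ℝ}
    (hp : 0 < p) : trConj p A (Z * star Z) = Tr ((star Z * A ^ p * Z) ^ (1 / p)) := by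
  obtain ⟨K, hK⟩ : ∃ K : E →L[ℂ] E, K = (Z * star Z) ^ (1 / 2 : ℝ) := ⟨_, rfl⟩
  have hKs : star K = K := by rw [hK, star_rpow]
  have hKK : K * star K = Z * star Z := by
    rw [hKs, hK, sqrt_mul_sqrt (mul_star_self_nonneg Z)]
  have hHc : IsCompactOperator (Z * star Z) := isCompactOperator_mul_of_left hZ _
  have hKc : IsCompactOperator K := isCompactOperator_of_star_mul_self (by
    rwa [hKs, ← congrArg (K * ·) hKs, hKK])
  rw [trConj, ← hK, ← Tr_rpow_conj_eq_of_mul_star_eq CFC.rpow_nonneg hKc hZ hKK (by positivity),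
    hKs]

/-- The family is completed to a Hilbert basis; the added vectors lie in the kernel of `B`, hence in
that of `B^t`. -/
theorem Tr_rpow_eq_sum {ι : Type*} [Fintype ι] {e : ι → E} (he : Orthonormal ℂ e)
    {B : E →L[ℂ] E} (hB0 : 0 ≤ B) (hB : ∀ x, (∀ i, ⟪e i, x⟫_ℂ = 0) → B x = 0) {t : ℝ}
    (ht : 0 < t) : Tr (B ^ t) = ∑ i, ENNReal.ofReal (quadForm (B ^ t) (e i)) := by
  obtain ⟨w, b, g, hinj, hg, hperp⟩ := exists_hilbertBasis_extending he
  rw [Tr_eq_tsum_quadForm b CFC.rpow_nonneg, ← tsum_fintype (L := .unconditional ι)]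
  simp_rw [← hg]
  refine (hinj.tsum_eq (f := fun j => ENNReal.ofReal (quadForm (B ^ t) (b j)))
    fun j hj => ?_).symm
  by_contra hj'
  have h1 : (B ^ (1 : ℝ)) (b j) = 0 := by
    rw [CFC.rpow_one B hB0]
    exact hB _ (hperp j hj')
  exact hj (by simp [quadForm, rpow_apply_eq_zero B one_pos ht h1])

theorem tendsto_rpow {X : Type*} {l : Filter X} {B : X → E →L[ℂ] E} {B₀ : E →L[ℂ] E}
    (hB : ∀ n, 0 ≤ B n) (hB₀ : 0 ≤ B₀) (h : Tendsto B l (𝓝 B₀)) {t : ℝ} (ht : 0 < t) :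
    Tendsto (fun n => B n ^ t) l (𝓝 (B₀ ^ t)) := by
  lift t to NNReal using ht.le
  have ht' : 0 < t := by exact_mod_cast ht
  simp_rw [← CFC.nnrpow_eq_rpow ht']
  exact (CFC.continuousOn_nnrpow t B₀ hB₀).tendsto.comp
    (tendsto_nhdsWithin_iff.2 ⟨h, Eventually.of_forall hB⟩)

theorem continuous_quadForm (x : E) : Continuous fun A : E →L[ℂ] E => quadForm A x := by
  unfold quadForm
  fun_prop

/-- The trace is not norm continuous in general; it is here because every operator lives on the same
finite family. -/
theorem tendsto_Tr_rpow {X ι : Type*} [Fintype ι] {e : ι → E} (he : Orthonormal ℂ e)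
    {l : Filter X} {B : X → E →L[ℂ] E} {B₀ : E →L[ℂ] E}
    (hB : ∀ n, 0 ≤ B n) (hB₀ : 0 ≤ B₀) (h : Tendsto B l (𝓝 B₀))
    (hBe : ∀ n x, (∀ i, ⟪e i, x⟫_ℂ = 0) → B n x = 0)
    (hBe₀ : ∀ x, (∀ i, ⟪e i, x⟫_ℂ = 0) → B₀ x = 0) {t : ℝ} (ht : 0 < t) :
    Tendsto (fun n => Tr (B n ^ t)) l (𝓝 (Tr (B₀ ^ t))) := by
  rw [Tr_rpow_eq_sum he hB₀ hBe₀ ht]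
  simp_rw [fun n => Tr_rpow_eq_sum he (hB n) (hBe n) ht]
  exact tendsto_finsetSum _ fun i _ => ENNReal.tendsto_ofReal
    (((continuous_quadForm (e i)).tendsto _).comp (tendsto_rpow hB hB₀ h ht))

theorem Tr_rpow_lt_top {ι : Type*} [Fintype ι] {e : ι → E} (he : Orthonormal ℂ e)
    {B : E →L[ℂ] E} (hB0 : 0 ≤ B) (hB : ∀ x, (∀ i, ⟪e i, x⟫_ℂ = 0) → B x = 0) {t : ℝ}
    (ht : 0 < t) : Tr (B ^ t) < ∞ := by
  rw [Tr_rpow_eq_sum he hB0 hB ht]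
  exact ENNReal.sum_lt_top.2 fun i _ => ENNReal.ofReal_lt_top

/-- The finite-rank operator `∑ᵢ |cᵢ⟩⟨eᵢ|`. -/
def ketBra {ι : Type*} [Fintype ι] (e c : ι → E) : E →L[ℂ] E :=
  ∑ i, InnerProductSpace.rankOne ℂ (c i) (e i)

section ketBra

variable {ι : Type*} [Fintype ι] (e c : ι → E)

theorem ketBra_apply (x : E) : ketBra e c x = ∑ i, ⟪e i, x⟫_ℂ • c i := by
  simp [ketBra]

theorem ketBra_apply_of_orthogonal {x : E} (hx : ∀ i, ⟪e i, x⟫_ℂ = 0) : ketBra e c x = 0 := by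
  simp [ketBra_apply, hx]

theorem ketBra_apply_self {e : ι → E} (he : Orthonormal ℂ e) (i : ι) : ketBra e c (e i) = c i := by
  classical
  simp [ketBra_apply, orthonormal_iff_ite.1 he]

theorem mul_ketBra (A : E →L[ℂ] E) : A * ketBra e c = ketBra e fun i => A (c i) := by
  ext x
  simp [ketBra_apply]

theorem finiteDimensional_range_mul_ketBra (A : E →L[ℂ] E) :
    FiniteDimensional ℂ (LinearMap.range ((ketBra e c * A : E →L[ℂ] E) : E →ₗ[ℂ] E)) := by
  have h : LinearMap.range ((ketBra e c * A : E →L[ℂ] E) : E →ₗ[ℂ] E) ≤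
      Submodule.span ℂ (Set.range c) := by
    rintro _ ⟨x, rfl⟩
    change ketBra e c (A x) ∈ _
    rw [ketBra_apply]
    exact Submodule.sum_mem _ fun i _ =>
      Submodule.smul_mem _ _ (Submodule.subset_span ⟨i, rfl⟩)
  have := FiniteDimensional.span_of_finite ℂ (Set.finite_range c)
  exact Submodule.finiteDimensional_of_le h

theorem isCompactOperator_ketBra : IsCompactOperator (ketBra e c) := by
  refine isCompactOperator_of_finiteDimensional_range _ ?_
  have := finiteDimensional_range_mul_ketBra e c 1
  rwa [mul_one] at this

theorem tendsto_ketBra {X : Type*} {l : Filter X} {v : X → ι → E} {c : ι → E}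
    (h : ∀ i, Tendsto (fun n => v n i) l (𝓝 (c i))) :
    Tendsto (fun n => ketBra e (v n)) l (𝓝 (ketBra e c)) := by
  refine tendsto_finsetSum _ fun i _ => ?_
  have : Continuous fun x : E => InnerProductSpace.rankOne ℂ x (e i) := by fun_prop
  exact (this.tendsto _).comp (h i)

end ketBra

/-! ### Douglas factorization -/

theorem mem_closure_range_of_mem_orthogonal_ker {S : E →L[ℂ] E} (hS : 0 ≤ S) {x : E}
    (hx : x ∈ (LinearMap.ker (S : E →ₗ[ℂ] E))ᗮ) : x ∈ closure (Set.range S) := by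
  have h1 : (LinearMap.range (S : E →ₗ[ℂ] E))ᗮ ≤ LinearMap.ker (S : E →ₗ[ℂ] E) := by
    intro y hy
    have h2 := (Submodule.mem_orthogonal _ _).1 hy (S (S y)) ⟨S y, rfl⟩
    rw [inner_apply_of_nonneg hS] at h2
    exact inner_self_eq_zero.1 h2
  have h3 := Submodule.orthogonal_le h1 hx
  rw [Submodule.orthogonal_orthogonal_eq_closure] at h3
  exact h3

/-- The bound says `‖T^(1/2) x‖ ≤ √K ‖S x‖`, so `S x ↦ T^(1/2) x` is well defined and bounded.
Extended to the closure of the range of `S` and by zero on its complement it is an operator `D` with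
`D S = T^(1/2)`, and `R = D* D`. -/
theorem exists_eq_conj_of_quadForm_le {S T : E →L[ℂ] E} (hS : star S = S) (hT : 0 ≤ T) {K : ℝ}
    (h : ∀ x, quadForm T x ≤ K * ‖S x‖ ^ 2) : ∃ R : E →L[ℂ] E, T = S * R * S := by
  let V : Submodule ℂ E := (LinearMap.range (S : E →ₗ[ℂ] E)).topologicalClosure
  have hV : CompleteSpace V := (Submodule.isClosed_topologicalClosure _).completeSpace_coe
  have hmem : ∀ x, S x ∈ V := fun x => Submodule.le_topologicalClosure _ ⟨x, rfl⟩
  let e : E →ₗ[ℂ] V := (S : E →ₗ[ℂ] E).codRestrict V hmem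
  have hdense : DenseRange e := by
    rw [DenseRange, Subtype.dense_iff]
    intro x hx
    have : ((↑) '' Set.range e : Set E) = Set.range S := by
      rw [← Set.range_comp]
      rfl
    exact closure_mono this.ge hx
  obtain ⟨W, hW⟩ : ∃ W : E →L[ℂ] E, W = T ^ (1 / 2 : ℝ) := ⟨_, rfl⟩
  have hWW : star W * W = T := by rw [hW, star_rpow, sqrt_mul_sqrt hT]
  have hbound : ∃ C, ∀ x, ‖(W : E →ₗ[ℂ] E) x‖ ≤ C * ‖e x‖ := by
    -- No sign of `K` is required: `√K = 0` for negative `K`.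
    refine ⟨√K, fun x => ?_⟩
    change ‖W x‖ ≤ √K * ‖S x‖
    have h1 := h x
    rw [← hWW, quadForm_star_mul_self] at h1
    calc ‖W x‖ = √(‖W x‖ ^ 2) := (Real.sqrt_sq (norm_nonneg _)).symm
      _ ≤ √(K * ‖S x‖ ^ 2) := Real.sqrt_le_sqrt h1
      _ = √K * ‖S x‖ := by rw [Real.sqrt_mul' _ (by positivity), Real.sqrt_sq (norm_nonneg _)]
  let D : E →L[ℂ] E := ((W : E →ₗ[ℂ] E).extendOfNorm e) ∘L V.orthogonalProjectionOnto
  have hD : D * S = W := by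
    ext x
    have h1 : V.orthogonalProjectionOnto (S x) = e x :=
      V.orthogonalProjectionOnto_mem_subspace_eq_self ⟨S x, hmem x⟩
    change (W : E →ₗ[ℂ] E).extendOfNorm e (V.orthogonalProjectionOnto (S x)) = W x
    rw [h1, LinearMap.extendOfNorm_eq hdense hbound]
    rfl
  refine ⟨star D * D, ?_⟩
  calc T = star (D * S) * (D * S) := by rw [hD, hWW]
    _ = S * (star D * D) * S := by rw [star_mul, hS]; simp only [mul_assoc]

/-! ### Diagonal finite-rank operators -/

theorem Tr_rpow_eq_sum_eigenvalues {ι : Type*} [Fintype ι] {e : ι → E} (he : Orthonormal ℂ e)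
    {B : E →L[ℂ] E} (hB0 : 0 ≤ B) (hB : ∀ x, (∀ i, ⟪e i, x⟫_ℂ = 0) → B x = 0) {m : ι → ℝ}
    (hm : ∀ i, B (e i) = (m i : ℂ) • e i) {t : ℝ} (ht : 0 < t) :
    Tr (B ^ t) = ∑ i, ENNReal.ofReal (m i ^ t) := by
  rw [Tr_rpow_eq_sum he hB0 hB ht]
  refine Finset.sum_congr rfl fun i _ => ?_
  rw [quadForm_of_eigenvector (rpow_apply_eigenvector hB0 (hm i) ht), he.1]
  simp

theorem inner_apply_self_eq_quadForm {A : E →L[ℂ] E} (hA : 0 ≤ A) (x : E) :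
    ⟪x, A x⟫_ℂ = (quadForm A x : ℂ) :=
  (RCLike.conj_eq_iff_re.1
    ((inner_conj_symm (A x) x).trans (inner_apply_of_nonneg hA x x))).symm

theorem star_ketBra {ι : Type*} [Fintype ι] (e c : ι → E) : star (ketBra e c) = ketBra c e := by
  simp [ketBra, ContinuousLinearMap.star_eq_adjoint]

theorem star_ketBra_smul_apply {ι : Type*} [Fintype ι] {e : ι → E} (he : Orthonormal ℂ e)
    (k : ι → ℝ) (i : ι) :
    star (ketBra e fun j => (k j : ℂ) • e j) (e i) = (k i : ℂ) • e i := by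
  classical
  rw [star_ketBra, ketBra_apply, Finset.sum_eq_single i]
  · rw [inner_smul_left, orthonormal_iff_ite.1 he]
    simp
  · intro j _ hj
    rw [inner_smul_left, orthonormal_iff_ite.1 he]
    simp [hj]
  · simp

theorem star_mul_self_ketBra_smul_apply {ι : Type*} [Fintype ι] {e : ι → E}
    (he : Orthonormal ℂ e) (k : ι → ℝ) (i : ι) :
    (star (ketBra e fun j => (k j : ℂ) • e j) * ketBra e fun j => (k j : ℂ) • e j) (e i) =
      ((k i ^ 2 : ℝ) : ℂ) • e i := by
  rw [mul_apply_eq_comp, ketBra_apply_self _ he, map_smul, star_ketBra_smul_apply he, smul_smul,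
    ← Complex.ofReal_mul, sq]

/-! ### Lower bounds -/

theorem obj_eq_coe {α z : ℝ} {ρ σ H : E →L[ℂ] E} (hF : trConj (α / z) ρ H ≠ ∞)
    (hG : trConj ((α - 1) / z) σ H ≠ ∞) :
    obj α z ρ σ H = ((α * (trConj (α / z) ρ H).toReal +
      (1 - α) * (trConj ((α - 1) / z) σ H).toReal : ℝ) : EReal) := by
  rw [obj, ← EReal.coe_ennreal_toReal hF, ← EReal.coe_ennreal_toReal hG]
  norm_cast

/-- The vectors `c i` are limits of `S (v i n)`. For `Z n` with columns `v i n`, the traces for `H =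
Z n (Z n)*` involve only `S (Z n)`, which converges to `ketBra e c`; both strict inequalities then
hold for some `n`. -/
theorem exists_lt_obj {α z : ℝ} (hα : 1 < α) (hz : 0 < z) {ρ σ R S : E →L[ℂ] E}
    (hR : 0 ≤ R) (hS : star S = S) (hρ : ρ ^ (α / z) = S * R * S)
    (hσ : σ ^ ((α - 1) / z) = S * S) {ι : Type*} [Fintype ι] {e c : ι → E}
    (he : Orthonormal ℂ e) (hc : ∀ i, c i ∈ closure (Set.range S))
    (hpos : 0 < Tr ((star (ketBra e c) * ketBra e c) ^ (1 / ((α - 1) / z)))) {y : ℝ}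
    (hy : y < α * (Tr ((star (ketBra e c) * R * ketBra e c) ^ (1 / (α / z)))).toReal +
      (1 - α) * (Tr ((star (ketBra e c) * ketBra e c) ^ (1 / ((α - 1) / z)))).toReal) :
    ∃ H ∈ HSetPos α z σ ∩ finRank E, (y : EReal) < obj α z ρ σ H := by
  have hα1 : 0 < α - 1 := by linarith
  have hα0 : 0 < α := by linarith
  have hv : ∀ i, ∃ v : ℕ → E, Tendsto (fun n => S (v n)) atTop (𝓝 (c i)) := fun i => by
    obtain ⟨x, hx, hxc⟩ := mem_closure_iff_seq_limit.1 (hc i)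
    choose v hv using hx
    exact ⟨v, by simpa only [hv] using hxc⟩
  choose v hv using hv
  let Z : ℕ → E →L[ℂ] E := fun n => ketBra e fun i => v i n
  let W : ℕ → E →L[ℂ] E := fun n => ketBra e fun i => S (v i n)
  have hSZ : ∀ n, S * Z n = W n := fun n => mul_ketBra _ _ S
  have hW : Tendsto W atTop (𝓝 (ketBra e c)) := tendsto_ketBra e hv
  have hsW : Tendsto (fun n => star (W n)) atTop (𝓝 (star (ketBra e c))) :=
    (continuous_star.tendsto _).comp hW
  have hker : ∀ (A : E →L[ℂ] E) (d : ι → E) (x : E), (∀ i, ⟪e i, x⟫_ℂ = 0) →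
      (A * ketBra e d) x = 0 := fun A d x hx => by
    rw [mul_apply_eq_comp, ketBra_apply_of_orthogonal e d hx, map_zero]
  have hZc : ∀ n, IsCompactOperator (Z n) := fun n => isCompactOperator_ketBra _ _
  have hF : ∀ n, trConj (α / z) ρ (Z n * star (Z n)) =
      Tr ((star (W n) * R * W n) ^ (1 / (α / z))) := fun n => by
    rw [trConj_mul_star (hZc n) _ (by positivity), hρ, ← hSZ, star_mul, hS]
    simp only [mul_assoc]
  have hG : ∀ n, trConj ((α - 1) / z) σ (Z n * star (Z n)) =
      Tr ((star (W n) * W n) ^ (1 / ((α - 1) / z))) := fun n => by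
    rw [trConj_mul_star (hZc n) _ (by positivity), hσ, ← hSZ, star_mul, hS]
    simp only [mul_assoc]
  have hF0 := star_mul_mul_nonneg (ketBra e c) hR
  have hG0 := star_mul_self_nonneg (ketBra e c)
  have htF : Tendsto (fun n => Tr ((star (W n) * R * W n) ^ (1 / (α / z)))) atTop
      (𝓝 (Tr ((star (ketBra e c) * R * ketBra e c) ^ (1 / (α / z))))) :=
    tendsto_Tr_rpow he (fun n => star_mul_mul_nonneg _ hR) hF0
      ((hsW.mul tendsto_const_nhds).mul hW) (fun n => hker _ _) (hker _ _) (by positivity)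
  have htG : Tendsto (fun n => Tr ((star (W n) * W n) ^ (1 / ((α - 1) / z)))) atTop
      (𝓝 (Tr ((star (ketBra e c) * ketBra e c) ^ (1 / ((α - 1) / z))))) :=
    tendsto_Tr_rpow he (fun n => star_mul_self_nonneg _) hG0
      (hsW.mul hW) (fun n => hker _ _) (hker _ _) (by positivity)
  have hFt : Tr ((star (ketBra e c) * R * ketBra e c) ^ (1 / (α / z))) ≠ ∞ :=
    (Tr_rpow_lt_top he hF0 (hker _ _) (by positivity)).ne
  have hGt : Tr ((star (ketBra e c) * ketBra e c) ^ (1 / ((α - 1) / z))) ≠ ∞ :=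
    (Tr_rpow_lt_top he hG0 (hker _ _) (by positivity)).ne
  have hlim := (((ENNReal.tendsto_toReal hFt).comp htF).const_mul α).add
    (((ENNReal.tendsto_toReal hGt).comp htG).const_mul (1 - α))
  obtain ⟨n, hn1, hn2⟩ := ((hlim.eventually_const_lt hy).and
    (htG.eventually_const_lt hpos)).exists
  have hFn : trConj (α / z) ρ (Z n * star (Z n)) < ∞ := by
    rw [hF]
    exact Tr_rpow_lt_top he (star_mul_mul_nonneg _ hR) (hker _ _) (by positivity)
  have hGn : trConj ((α - 1) / z) σ (Z n * star (Z n)) < ∞ := by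
    rw [hG]
    exact Tr_rpow_lt_top he (star_mul_self_nonneg _) (hker _ _) (by positivity)
  refine ⟨Z n * star (Z n), ⟨⟨mul_star_self_nonneg _, ?_, hGn⟩,
    finiteDimensional_range_mul_ketBra _ _ _⟩, ?_⟩
  · rw [hG]
    exact hn2
  · rw [obj_eq_coe hFn.ne hGn.ne, hF, hG]
    exact_mod_cast hn1

theorem exists_lt_obj_of_isCompactOperator {α z : ℝ} (hα : 1 < α) (hz : 0 < z)
    {ρ σ R S : E →L[ℂ] E} (hR : 0 ≤ R) (hS : 0 ≤ S) (hρ : ρ ^ (α / z) = S * R * S)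
    (hσ : σ ^ ((α - 1) / z) = S * S)
    (hker : LinearMap.ker (S : E →ₗ[ℂ] E) ≤ LinearMap.ker (R : E →ₗ[ℂ] E))
    (hc : IsCompactOperator R) {y : ℝ} (hy0 : 0 ≤ y) (hy : ENNReal.ofReal y < Tr (R ^ z)) :
    ∃ H ∈ HSetPos α z σ ∩ finRank E, (y : EReal) < obj α z ρ σ H := by
  have hα1 : 0 < α - 1 := by linarith
  have hα0 : 0 < α := by linarith
  obtain ⟨ι, b, a, ha, hb⟩ := exists_eigenbasis hR hc
  rw [Tr_rpow_eq_tsum_eigenvalues b hR hb hz,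
    tsum_eq_tsum_pos ha fun i hi => by rw [hi, Real.zero_rpow hz.ne', ENNReal.ofReal_zero],
    ENNReal.tsum_eq_iSup_sum, lt_iSup_iff] at hy
  obtain ⟨s, hs⟩ := hy
  rw [← Finset.sum_coe_sort s] at hs
  let e : s → E := fun i => b i
  let r : s → ℝ := fun i => a i
  have hr : ∀ i, 0 < r i := fun i => i.1.2
  have he : Orthonormal ℂ e :=
    b.orthonormal.comp _ (Subtype.val_injective.comp Subtype.val_injective)
  have hRe : ∀ i, R (e i) = (r i : ℂ) • e i := fun i => hb _
  -- The equality case of Hölder: `C = R^((α-1)/2)` on the chosen eigenvectors gives `C* C =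
  -- R^(α-1)` and `C* R C = R^α` there.
  let k : s → ℝ := fun i => r i ^ ((α - 1) / 2)
  have hk : ∀ i, k i ^ 2 = r i ^ (α - 1) := fun i => by
    rw [← Real.rpow_natCast, ← Real.rpow_mul (hr i).le]
    congr 1
    push_cast
    ring
  let c : s → E := fun i => (k i : ℂ) • e i
  have hkerC : ∀ (A : E →L[ℂ] E) (x : E), (∀ i, ⟪e i, x⟫_ℂ = 0) → (A * ketBra e c) x = 0 :=
    fun A x hx => by rw [mul_apply_eq_comp, ketBra_apply_of_orthogonal e c hx, map_zero]
  have hG : Tr ((star (ketBra e c) * ketBra e c) ^ (1 / ((α - 1) / z))) =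
      ∑ i, ENNReal.ofReal (r i ^ z) := by
    rw [Tr_rpow_eq_sum_eigenvalues he (star_mul_self_nonneg _) (hkerC _)
      (star_mul_self_ketBra_smul_apply he k) (by positivity)]
    refine Finset.sum_congr rfl fun i _ => ?_
    rw [hk, ← Real.rpow_mul (hr i).le]
    congr 2
    field_simp
  have hF : Tr ((star (ketBra e c) * R * ketBra e c) ^ (1 / (α / z))) =
      ∑ i, ENNReal.ofReal (r i ^ z) := by
    rw [Tr_rpow_eq_sum_eigenvalues (m := fun i => r i ^ α) he (star_mul_mul_nonneg _ hR)
      (hkerC _) (fun i => ?_) (by positivity)]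
    · refine Finset.sum_congr rfl fun i _ => ?_
      rw [← Real.rpow_mul (hr i).le]
      congr 2
      field_simp
    · rw [mul_apply_eq_comp, mul_apply_eq_comp, ketBra_apply_self _ he, map_smul, hRe, map_smul,
        map_smul, star_ketBra_smul_apply he, smul_smul, smul_smul]
      have h1 : k i * r i * k i = r i ^ α := by
        calc k i * r i * k i = k i ^ 2 * r i := by ring
          _ = r i ^ (α - 1) * r i ^ (1 : ℝ) := by rw [hk, Real.rpow_one]
          _ = r i ^ α := by rw [← Real.rpow_add (hr i), sub_add_cancel]
      rw [← h1]
      push_cast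
      rfl
  have hq : (∑ i, ENNReal.ofReal (r i ^ z)) ≠ ∞ :=
    (ENNReal.sum_lt_top.2 fun i _ => ENNReal.ofReal_lt_top).ne
  have hyq : y < (∑ i, ENNReal.ofReal (r i ^ z)).toReal := by
    rw [← ENNReal.ofReal_lt_iff_lt_toReal hy0 hq]
    exact hs
  refine exists_lt_obj hα hz hR (star_eq_of_nonneg hS) hρ hσ he (c := c) (fun i => ?_) ?_ ?_
  -- An eigenvector with nonzero eigenvalue is orthogonal to `ker R`, which contains `ker S`.
  · refine mem_closure_range_of_mem_orthogonal_ker hS (Submodule.orthogonal_le hker ?_)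
    refine Submodule.smul_mem _ _ ?_
    rw [Submodule.mem_orthogonal]
    intro x hx
    have hx0 : R x = 0 := hx
    have h1 : ⟪x, R (e i)⟫_ℂ = 0 := by rw [← inner_apply_of_nonneg hR, hx0, inner_zero_left]
    rw [hRe, inner_smul_right] at h1
    exact (mul_eq_zero.1 h1).resolve_left (by exact_mod_cast (hr i).ne')
  · rw [hG]
    exact zero_le.trans_lt hs
  · rw [hF, hG]
    linarith

theorem real_smul_apply (c : ℝ) (A : E →L[ℂ] E) (x : E) : (c • A) x = (c : ℂ) • A x := by
  simp

/-- For `w ≥ 1` this is Jensen; for `w ≤ 1` it is operator monotonicity of `x^w` applied to `c C* C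
≤ C* R C`. -/
theorem le_quadForm_rpow_conj {R C : E →L[ℂ] E} (hR : 0 ≤ R) {m c : ℝ} (hm : 0 ≤ m) (hc : 0 ≤ c)
    (hRC : ∀ x, c * ‖C x‖ ^ 2 ≤ quadForm R (C x)) {e : E} (he : ‖e‖ = 1)
    (hCe : (star C * C) e = (m : ℂ) • e) {w : ℝ} (hw : 0 < w) :
    (c * m) ^ w ≤ quadForm ((star C * R * C) ^ w) e := by
  have hB := star_mul_mul_nonneg C hR
  have h1 : c * m ≤ quadForm (star C * R * C) e := by
    have h2 := hRC e
    rw [← quadForm_star_mul_self, quadForm_of_eigenvector hCe, he] at h2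
    rw [quadForm_star_mul_mul]
    linarith
  rcases le_total 1 w with h1w | hw1
  · exact (Real.rpow_le_rpow (by positivity) h1 hw.le).trans (quadForm_rpow_ge hB he h1w)
  · obtain ⟨D, hDeq⟩ : ∃ D, D = star C * C := ⟨_, rfl⟩
    have hD0 : 0 ≤ D := hDeq ▸ star_mul_self_nonneg C
    have hcD0 : 0 ≤ c • D := smul_nonneg hc hD0
    have hle : c • D ≤ star C * R * C := by
      rw [← sub_nonneg]
      refine nonneg_of_quadForm ((IsSelfAdjoint.of_nonneg hB).sub
        (IsSelfAdjoint.of_nonneg hcD0)) fun x => ?_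
      rw [quadForm_sub, quadForm_real_smul, hDeq, quadForm_star_mul_self, quadForm_star_mul_mul]
      linarith [hRC x]
    have hD : (c • D) e = ((c * m : ℝ) : ℂ) • e := by
      rw [real_smul_apply, hDeq, hCe, smul_smul, ← Complex.ofReal_mul]
    have h3 := quadForm_mono (CFC.rpow_le_rpow ⟨hw.le, hw1⟩ hle) e
    rw [quadForm_of_eigenvector (rpow_apply_eigenvector hcD0 hD hw), he] at h3
    linarith

theorem exists_lt_obj_of_not_isCompactOperator {α z : ℝ} (hα : 1 < α) (hz : 0 < z)
    {ρ σ R S : E →L[ℂ] E} (hR : 0 ≤ R) (hS : 0 ≤ S) (hρ : ρ ^ (α / z) = S * R * S)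
    (hσ : σ ^ ((α - 1) / z) = S * S)
    (hker : LinearMap.ker (S : E →ₗ[ℂ] E) ≤ LinearMap.ker (R : E →ₗ[ℂ] E))
    (hc : ¬ IsCompactOperator R) (y : ℝ) :
    ∃ H ∈ HSetPos α z σ ∩ finRank E, (y : EReal) < obj α z ρ σ H := by
  have hα1 : 0 < α - 1 := by linarith
  have hα0 : 0 < α := by linarith
  obtain ⟨c, M, hc0, hM, hMker, hMq⟩ := exists_submodule_of_not_isCompactOperator hR hc
  obtain ⟨e', he', heM⟩ := exists_orthonormal_nat M hM
  obtain ⟨w, hw⟩ : ∃ w, w = 1 / (α / z) := ⟨_, rfl⟩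
  obtain ⟨u, hu⟩ : ∃ u, u = 1 / ((α - 1) / z) := ⟨_, rfl⟩
  have hw0 : 0 < w := by rw [hw]; positivity
  have hu0 : 0 < u := by rw [hu]; positivity
  have hwu : 0 < u - w := by
    rw [hw, hu, sub_pos]
    exact one_div_lt_one_div_of_lt (by positivity) (by gcongr; linarith)
  -- This scale makes `m^u = (c m)^w`, so each of the `N` vectors adds at least `α (c m)^w + (1-α)
  -- m^u = (c m)^w` to the objective.
  obtain ⟨m, hm0, hm⟩ : ∃ m : ℝ, 0 < m ∧ m ^ (u - w) = c ^ w :=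
    ⟨(c ^ w) ^ (u - w)⁻¹, by positivity, Real.rpow_inv_rpow (by positivity) hwu.ne'⟩
  have hmu : m ^ u = (c * m) ^ w := by
    rw [Real.mul_rpow hc0.le hm0.le, ← hm, ← Real.rpow_add hm0, sub_add_cancel]
  have hδ : 0 < (c * m) ^ w := by positivity
  obtain ⟨N, hN⟩ := exists_nat_gt (max (y / (c * m) ^ w) 0)
  have hyN : y < N * (c * m) ^ w := by
    rw [← div_lt_iff₀ hδ]
    exact (le_max_left _ _).trans_lt hN
  have hN0 : (0 : ℝ) < N := (le_max_right _ _).trans_lt hN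
  let e : Fin N → E := fun i => e' i
  have he : Orthonormal ℂ e := he'.comp _ Fin.val_injective
  let k : Fin N → ℝ := fun _ => √m
  let d : Fin N → E := fun i => (k i : ℂ) • e i
  have hdM : ∀ i, d i ∈ M := fun i => M.smul_mem _ (heM _)
  have hkerC : ∀ (A : E →L[ℂ] E) (x : E), (∀ i, ⟪e i, x⟫_ℂ = 0) → (A * ketBra e d) x = 0 :=
    fun A x hx => by rw [mul_apply_eq_comp, ketBra_apply_of_orthogonal e d hx, map_zero]
  have hCe : ∀ i, (star (ketBra e d) * ketBra e d) (e i) = (m : ℂ) • e i := fun i => by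
    rw [star_mul_self_ketBra_smul_apply he k, Real.sq_sqrt hm0.le]
  have hG : Tr ((star (ketBra e d) * ketBra e d) ^ u) = ENNReal.ofReal (N * (c * m) ^ w) := by
    rw [Tr_rpow_eq_sum_eigenvalues he (star_mul_self_nonneg _) (hkerC _) hCe hu0]
    simp [hmu, ENNReal.ofReal_mul]
  have hF : ENNReal.ofReal (N * (c * m) ^ w) ≤
      Tr ((star (ketBra e d) * R * ketBra e d) ^ w) := by
    rw [Tr_rpow_eq_sum he (star_mul_mul_nonneg _ hR) (hkerC _) hw0]
    calc _ = ∑ _i : Fin N, ENNReal.ofReal ((c * m) ^ w) := by simp [ENNReal.ofReal_mul]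
      _ ≤ _ := Finset.sum_le_sum fun i _ => ENNReal.ofReal_le_ofReal
        (le_quadForm_rpow_conj hR hm0.le hc0.le (fun x => ?_) (he.1 i) (hCe i) hw0)
    have h1 := hMq 1 one_pos (ketBra e d x) (by
      rw [ketBra_apply]
      exact Submodule.sum_mem _ fun i _ => M.smul_mem _ (hdM i))
    rwa [Real.rpow_one, CFC.rpow_one R hR] at h1
  have hFt : Tr ((star (ketBra e d) * R * ketBra e d) ^ w) ≠ ∞ :=
    (Tr_rpow_lt_top he (star_mul_mul_nonneg _ hR) (hkerC _) hw0).ne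
  have hpos : 0 < (N : ℝ) * (c * m) ^ w := by positivity
  refine exists_lt_obj hα hz hR (star_eq_of_nonneg hS) hρ hσ he (c := d) (fun i => ?_) ?_ ?_
  · exact mem_closure_range_of_mem_orthogonal_ker hS (Submodule.orthogonal_le hker (hMker (hdM i)))
  · rw [← hu, hG]
    exact ENNReal.ofReal_pos.2 hpos
  · rw [← hu, ← hw, hG, ENNReal.toReal_ofReal hpos.le]
    have h2 := (ENNReal.ofReal_le_iff_le_toReal hFt).1 hF
    nlinarith

theorem star_ketBra_mul_ketBra_apply {A : E →L[ℂ] E} (hA : 0 ≤ A) {e : Unit → E}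
    (he : Orthonormal ℂ e) (x : E) :
    (star (ketBra e fun _ => x) * A * ketBra e fun _ => x) (e ()) = (quadForm A x : ℂ) • e () := by
  rw [mul_apply_eq_comp, mul_apply_eq_comp, ketBra_apply_self _ he, star_ketBra, ketBra_apply]
  simp [inner_apply_self_eq_quadForm hA]

theorem trConj_rankOne {A : E →L[ℂ] E} {e : Unit → E} (he : Orthonormal ℂ e) (x : E) {p : ℝ}
    (hp : 0 < p) : trConj p A ((ketBra e fun _ => x) * star (ketBra e fun _ => x)) =
      ENNReal.ofReal (quadForm (A ^ p) x ^ (1 / p)) := by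
  rw [trConj_mul_star (isCompactOperator_ketBra _ _) _ hp,
    Tr_rpow_eq_sum_eigenvalues (m := fun _ => quadForm (A ^ p) x) he
      (star_mul_mul_nonneg _ CFC.rpow_nonneg) (fun v hv => ?_)
      (fun _ => star_ketBra_mul_ketBra_apply CFC.rpow_nonneg he x) (by positivity)]
  · simp
  · rw [mul_apply_eq_comp, ketBra_apply_of_orthogonal _ _ hv, map_zero]

/-- Otherwise, by scaling, the form of `T` would be bounded by `K ‖S x‖²`, and Douglas factorization
would apply. -/
theorem exists_quadForm_gt {S T : E →L[ℂ] E} (hS : star S = S) (hS0 : S ≠ 0) (hT : 0 ≤ T)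
    (hST : ¬ ∃ R : E →L[ℂ] E, T = S * R * S) (K : ℝ) : ∃ x, ‖S x‖ = 1 ∧ K < quadForm T x := by
  by_contra! hcon
  refine hST (exists_eq_conj_of_quadForm_le hS hT (K := K) ?_)
  have h1 : ∀ x, S x ≠ 0 → quadForm T x ≤ K * ‖S x‖ ^ 2 := fun x hx => by
    have hn : 0 < ‖S x‖ := norm_pos_iff.2 hx
    have h2 := hcon (((‖S x‖⁻¹ : ℝ) : ℂ) • x) (by
      rw [map_smul, norm_smul, Complex.norm_real, norm_inv, norm_norm, inv_mul_cancel₀ hn.ne'])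
    rw [quadForm_smul, Complex.norm_real, norm_inv, norm_norm, inv_pow,
      inv_mul_le_iff₀ (by positivity)] at h2
    linarith
  obtain ⟨v, hv⟩ : ∃ v, S v ≠ 0 := by
    by_contra! h
    exact hS0 (ContinuousLinearMap.ext h)
  intro x
  by_cases hx : S x = 0
  -- Vectors killed by `S` cannot be normalized; they are limits of vectors that are not killed.
  · have hlim : Tendsto (fun n : ℕ => x + ((1 / ((n : ℝ) + 1) : ℝ) : ℂ) • v) atTop (𝓝 x) := by
      have h3 : Tendsto (fun n : ℕ => ((1 / ((n : ℝ) + 1) : ℝ) : ℂ)) atTop (𝓝 ((0 : ℝ) : ℂ)) :=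
        (Complex.continuous_ofReal.tendsto 0).comp tendsto_one_div_add_atTop_nhds_zero_nat
      simpa using (h3.smul_const v).const_add x
    have hcl : IsClosed {x | quadForm T x ≤ K * ‖S x‖ ^ 2} := by
      unfold quadForm
      exact isClosed_le (by fun_prop) (by fun_prop)
    refine hcl.mem_of_tendsto hlim (Eventually.of_forall fun n => h1 _ ?_)
    rw [map_add, hx, zero_add, map_smul]
    refine smul_ne_zero ?_ hv
    exact_mod_cast (Nat.one_div_pos_of_nat (α := ℝ)).ne'
  · exact h1 x hx

theorem exists_lt_obj_of_notMem_BSet {α z : ℝ} (hα : 1 < α) (hz : 0 < z)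
    {ρ σ : E →L[ℂ] E} (hρ : 0 ≤ ρ) (hρ0 : ρ ≠ 0) (hσ : 0 ≤ σ) (hσ0 : σ ≠ 0)
    (h : ρ ∉ BSet α z σ) (y : ℝ) :
    ∃ H ∈ HSetPos α z σ ∩ finRank E, (y : EReal) < obj α z ρ σ H := by
  have hα1 : 0 < α - 1 := by linarith
  have hα0 : 0 < α := by linarith
  obtain ⟨S, hS⟩ : ∃ S, S = σ ^ ((α - 1) / (2 * z)) := ⟨_, rfl⟩
  have hSs : star S = S := by rw [hS, star_rpow]
  have hSS : σ ^ ((α - 1) / z) = star S * S := by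
    rw [hSs, hS, ← rpow_add_pos _ (by positivity) (by positivity)]
    congr 1
    field_simp
    ring
  have hS0 : S ≠ 0 := fun h0 => hσ0 (by
    have h1 := ker_rpow hσ (p := (α - 1) / (2 * z)) (by positivity)
    rw [← hS, h0] at h1
    ext x
    have hx : x ∈ LinearMap.ker (σ : E →ₗ[ℂ] E) := by
      rw [← h1]
      rfl
    exact hx)
  obtain ⟨w, hw⟩ : ∃ w, w = 1 / (α / z) := ⟨_, rfl⟩
  have hw0 : 0 < w := by rw [hw]; positivity
  -- The threshold ensures `α F ≥ |y| + α`, and `G = 1` since `‖S x‖ = 1`; hence `α F + (1-α) G ≥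
  -- |y| + 1 > y`.
  obtain ⟨x, hx1, hxK⟩ := exists_quadForm_gt hSs hS0 (T := ρ ^ (α / z)) CFC.rpow_nonneg
    (fun ⟨R, hR⟩ => h ⟨hρ, hρ0, R, by rw [← hS]; exact hR⟩) (((|y| + α) / α) ^ w⁻¹)
  have hx0 : x ≠ 0 := by
    rintro rfl
    simp at hx1
  let e : Unit → E := fun _ => ((‖x‖⁻¹ : ℝ) : ℂ) • x
  have he : Orthonormal ℂ e := by
    refine ⟨fun _ => ?_, fun i j hij => absurd rfl hij⟩
    rw [norm_smul, Complex.norm_real, norm_inv, norm_norm, inv_mul_cancel₀ (norm_ne_zero_iff.2 hx0)]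
  have hq0 : 0 ≤ quadForm (ρ ^ (α / z)) x := quadForm_nonneg CFC.rpow_nonneg x
  have hF := trConj_rankOne (A := ρ) he x (p := α / z) (by positivity)
  have hG := trConj_rankOne (A := σ) he x (p := (α - 1) / z) (by positivity)
  rw [hSS, quadForm_star_mul_self, hx1, one_pow, Real.one_rpow, ENNReal.ofReal_one] at hG
  refine ⟨_, ⟨⟨mul_star_self_nonneg (ketBra e fun _ => x), ?_, ?_⟩,
    finiteDimensional_range_mul_ketBra _ _ _⟩, ?_⟩
  · rw [hG]
    exact one_pos
  · rw [hG]
    exact ENNReal.one_lt_top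
  · rw [obj_eq_coe (by rw [hF]; exact ENNReal.ofReal_ne_top)
      (by rw [hG]; exact ENNReal.one_ne_top), hF, hG, ENNReal.toReal_ofReal
      (Real.rpow_nonneg hq0 _), ENNReal.toReal_one, ← hw]
    have h1 : (|y| + α) / α ≤ quadForm (ρ ^ (α / z)) x ^ w := by
      calc (|y| + α) / α = (((|y| + α) / α) ^ w⁻¹) ^ w :=
            (Real.rpow_inv_rpow (by positivity) hw0.ne').symm
        _ ≤ _ := Real.rpow_le_rpow (by positivity) hxK.le hw0.le
    rw [div_le_iff₀ hα0] at h1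
    have h2 := le_abs_self y
    exact_mod_cast (by linarith : y < α * quadForm (ρ ^ (α / z)) x ^ w + (1 - α) * 1)

/-! ### The relative operator and the two bounds -/

theorem exists_rel_factorization {α z : ℝ} (hα : 1 < α) (hz : 0 < z) {ρ σ : E →L[ℂ] E}
    (hσ : 0 ≤ σ) (h : ρ ∈ BSet α z σ) :
    ∃ R S : E →L[ℂ] E, 0 ≤ R ∧ 0 ≤ S ∧ ρ ^ (α / z) = S * R * S ∧ σ ^ ((α - 1) / z) = S * S ∧
      LinearMap.ker (S : E →ₗ[ℂ] E) ≤ LinearMap.ker (R : E →ₗ[ℂ] E) ∧ Q α z ρ σ = Tr (R ^ z) := by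
  have hα1 : 0 < α - 1 := by linarith
  obtain ⟨hR, hsupp, hρ⟩ := isRel_rel hα hz hσ h
  rw [suppProj_le_iff] at hsupp
  refine ⟨rel α z ρ σ, _, hR, CFC.rpow_nonneg, hρ, ?_, ?_, ?_⟩
  · rw [← rpow_add_pos _ (by positivity) (by positivity)]
    congr 1
    field_simp
    ring
  · rwa [ker_rpow hσ (by positivity)]
  · rw [Q, if_pos h]

theorem eq_zero_of_Tr_eq_zero {A : E →L[ℂ] E} (hA : 0 ≤ A) (h : Tr A = 0) : A = 0 := by
  rw [Tr_eq_tsum_quadForm (onb E) hA, ENNReal.tsum_eq_zero] at h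
  refine ContinuousLinearMap.ext_on
    (Submodule.dense_iff_topologicalClosure_eq_top.2 (onb E).dense_span) ?_
  rintro _ ⟨i, rfl⟩
  exact apply_eq_zero_of_quadForm_eq_zero hA
    (le_antisymm (ENNReal.ofReal_eq_zero.1 (h i)) (quadForm_nonneg hA _))

theorem eq_zero_of_rpow_eq_zero {A : E →L[ℂ] E} (hA : 0 ≤ A) {t : ℝ} (ht : 0 < t)
    (h : A ^ t = 0) : A = 0 := by
  ext x
  have h1 : (A ^ (1 : ℝ)) x = 0 := rpow_apply_eq_zero A ht one_pos (by rw [h]; rfl)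
  rwa [CFC.rpow_one A hA] at h1

theorem Q_pos {α z : ℝ} (hα : 1 < α) (hz : 0 < z) {ρ σ : E →L[ℂ] E} (hρ : 0 ≤ ρ) (hρ0 : ρ ≠ 0)
    (hσ : 0 ≤ σ) : 0 < Q α z ρ σ := by
  by_cases h : ρ ∈ BSet α z σ
  · obtain ⟨R, S, hR, -, hρS, -, -, hQ⟩ := exists_rel_factorization hα hz hσ h
    rw [hQ, pos_iff_ne_zero]
    intro h0
    have hR0 := eq_zero_of_rpow_eq_zero hR hz (eq_zero_of_Tr_eq_zero CFC.rpow_nonneg h0)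
    rw [hR0, mul_zero, zero_mul] at hρS
    exact hρ0 (eq_zero_of_rpow_eq_zero hρ (by positivity) hρS)
  · rw [Q, if_neg h]
    exact ENNReal.zero_lt_top

/-- Joins the three lower bounds; the split is on the existence and the compactness of `R`, and the
test operators have finite rank throughout. -/
theorem exists_lt_obj_of_lt_Q {α z : ℝ} (hα : 1 < α) (hz : 0 < z) {ρ σ : E →L[ℂ] E}
    (hρ : 0 ≤ ρ) (hρ0 : ρ ≠ 0) (hσ : 0 ≤ σ) (hσ0 : σ ≠ 0) {y : ℝ} (hy0 : 0 ≤ y)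
    (hy : ENNReal.ofReal y < Q α z ρ σ) :
    ∃ H ∈ HSetPos α z σ ∩ finRank E, (y : EReal) < obj α z ρ σ H := by
  by_cases h : ρ ∈ BSet α z σ
  · obtain ⟨R, S, hR, hS, hρS, hσS, hker, hQ⟩ := exists_rel_factorization hα hz hσ h
    by_cases hc : IsCompactOperator R
    · exact exists_lt_obj_of_isCompactOperator hα hz hR hS hρS hσS hker hc hy0 (hQ ▸ hy)
    · exact exists_lt_obj_of_not_isCompactOperator hα hz hR hS hρS hσS hker hc y
  · exact exists_lt_obj_of_notMem_BSet hα hz hρ hρ0 hσ hσ0 h y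

/-! ### Upper bounds on the objectives, and the passage to logarithms. -/

/-- Hölder for `Y = S H^(1/2)` with exponents `z/α`, `z` and `z/(α-1)`. -/
theorem trConj_le {α z : ℝ} (hα : 1 < α) (hz : 0 < z) {ρ σ H : E →L[ℂ] E} (hσ : 0 ≤ σ)
    (hQ : Q α z ρ σ ≠ ∞) (hH : H ∈ HSet α z σ) :
    trConj (α / z) ρ H ≤
      Q α z ρ σ ^ (1 / α) * trConj ((α - 1) / z) σ H ^ ((α - 1) / α) := by
  have hα1 : 0 < α - 1 := by linarith
  have hα0 : 0 < α := by linarith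
  have h : ρ ∈ BSet α z σ := by
    by_contra h
    exact hQ (by rw [Q, if_neg h])
  obtain ⟨R, S, hR, hS, hρS, hσS, -, hQR⟩ := exists_rel_factorization hα hz hσ h
  have hS' := star_eq_of_nonneg hS
  obtain ⟨K, hK⟩ : ∃ K, K = H ^ (1 / 2 : ℝ) := ⟨_, rfl⟩
  have hK' : star K = K := by rw [hK, star_rpow]
  have e1 : star (S * K) * R * (S * K) = K * ρ ^ (α / z) * K := by
    rw [star_mul, hS', hK', hρS]
    simp only [mul_assoc]
  have e2 : star (S * K) * (S * K) = K * σ ^ ((α - 1) / z) * K := by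
    rw [star_mul, hS', hK', hσS]
    simp only [mul_assoc]
  have hG := hH.2
  rw [trConj, ← hK, ← e2] at hG
  have h1 := Tr_rpow_conj_le (Y := S * K) hR (w := 1 / (α / z)) (z := z)
    (u := 1 / ((α - 1) / z)) (by positivity) hz (by positivity) (by field_simp; ring)
    (by rw [← hQR]; exact hQ.lt_top) hG
  rw [trConj, trConj, ← hK, ← e1, ← e2, hQR]
  convert h1 using 3 <;> field_simp

/-- Weighted AM-GM with weights `1/α` and `(α-1)/α`. -/
theorem add_le_of_le_rpow_mul_rpow {α f g q : ℝ} (hα : 1 < α) (hg : 0 ≤ g) (hq : 0 ≤ q)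
    (h : f ≤ q ^ (1 / α) * g ^ ((α - 1) / α)) : α * f + (1 - α) * g ≤ q := by
  have hα1 : 0 < α - 1 := by linarith
  have hα0 : 0 < α := by linarith
  have h1 := h.trans (Real.geom_mean_le_arith_mean2_weighted (by positivity) (by positivity) hq hg
    (by field_simp; ring))
  have h2 : α * (1 / α * q + (α - 1) / α * g) = q + (α - 1) * g := by field_simp
  have h3 := mul_le_mul_of_nonneg_left h1 hα0.le
  rw [h2] at h3
  linarith

theorem toReal_trConj_le {α z : ℝ} (hα : 1 < α) (hz : 0 < z) {ρ σ H : E →L[ℂ] E} (hσ : 0 ≤ σ)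
    (hQ : Q α z ρ σ ≠ ∞) (hH : H ∈ HSet α z σ) :
    trConj (α / z) ρ H ≠ ∞ ∧ (trConj (α / z) ρ H).toReal ≤
      (Q α z ρ σ).toReal ^ (1 / α) * (trConj ((α - 1) / z) σ H).toReal ^ ((α - 1) / α) := by
  have hα1 : 0 < α - 1 := by linarith
  have h1 := trConj_le hα hz hσ hQ hH
  have h2 : Q α z ρ σ ^ (1 / α) * trConj ((α - 1) / z) σ H ^ ((α - 1) / α) ≠ ∞ :=
    ENNReal.mul_ne_top (ENNReal.rpow_ne_top_of_nonneg (by positivity) hQ)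
      (ENNReal.rpow_ne_top_of_nonneg (by positivity) hH.2.ne)
  refine ⟨(h1.trans_lt h2.lt_top).ne, ?_⟩
  have h3 := ENNReal.toReal_mono h2 h1
  rwa [ENNReal.toReal_mul, ← ENNReal.toReal_rpow, ← ENNReal.toReal_rpow] at h3

theorem obj_le_Q {α z : ℝ} (hα : 1 < α) (hz : 0 < z) {ρ σ H : E →L[ℂ] E} (hσ : 0 ≤ σ)
    (hH : H ∈ HSet α z σ) : obj α z ρ σ H ≤ (Q α z ρ σ : EReal) := by
  by_cases hQ : Q α z ρ σ = ∞
  · rw [hQ]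
    exact le_top
  obtain ⟨hF, hle⟩ := toReal_trConj_le hα hz hσ hQ hH
  rw [obj_eq_coe hF hH.2.ne, ← EReal.coe_ennreal_toReal hQ, EReal.coe_le_coe_iff]
  exact add_le_of_le_rpow_mul_rpow hα ENNReal.toReal_nonneg ENNReal.toReal_nonneg hle

theorem logObj_eq_coe {α z : ℝ} {ρ σ H : E →L[ℂ] E} (hF0 : trConj (α / z) ρ H ≠ 0)
    (hF : trConj (α / z) ρ H ≠ ∞) (hG0 : trConj ((α - 1) / z) σ H ≠ 0)
    (hG : trConj ((α - 1) / z) σ H ≠ ∞) :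
    logObj α z ρ σ H = ((α * Real.log (trConj (α / z) ρ H).toReal +
      (1 - α) * Real.log (trConj ((α - 1) / z) σ H).toReal : ℝ) : EReal) := by
  rw [logObj, ENNReal.log_pos_real hF0 hF, ENNReal.log_pos_real hG0 hG]
  norm_cast

theorem logObj_le_log_Q {α z : ℝ} (hα : 1 < α) (hz : 0 < z) {ρ σ H : E →L[ℂ] E} (hσ : 0 ≤ σ)
    (hH : H ∈ HSetPos α z σ) : logObj α z ρ σ H ≤ ENNReal.log (Q α z ρ σ) := by
  have hα1 : 0 < α - 1 := by linarith
  have hα0 : 0 < α := by linarith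
  by_cases hQ : Q α z ρ σ = ∞
  · rw [hQ]
    exact le_top
  obtain ⟨hF, hle⟩ := toReal_trConj_le hα hz hσ hQ ⟨hH.1, hH.2.2⟩
  by_cases hF0 : trConj (α / z) ρ H = 0
  · rw [logObj, hF0, ENNReal.log_zero, EReal.coe_mul_bot_of_pos hα0, EReal.bot_add]
    exact bot_le
  have hf := ENNReal.toReal_pos hF0 hF
  have hg := ENNReal.toReal_pos hH.2.1.ne' hH.2.2.ne
  have hQ0 : Q α z ρ σ ≠ 0 := by
    intro h0
    rw [h0, ENNReal.toReal_zero, Real.zero_rpow (by positivity), zero_mul] at hle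
    linarith
  have hq := ENNReal.toReal_pos hQ0 hQ
  rw [logObj_eq_coe hF0 hF hH.2.1.ne' hH.2.2.ne, ENNReal.log_pos_real hQ0 hQ, EReal.coe_le_coe_iff]
  have h1 := Real.log_le_log hf hle
  rw [Real.log_mul (by positivity) (by positivity), Real.log_rpow hq, Real.log_rpow hg] at h1
  have h2 := mul_le_mul_of_nonneg_left h1 hα0.le
  have h3 : α * (1 / α * Real.log (Q α z ρ σ).toReal +
      (α - 1) / α * Real.log (trConj ((α - 1) / z) σ H).toReal) = Real.log (Q α z ρ σ).toReal +
      (α - 1) * Real.log (trConj ((α - 1) / z) σ H).toReal := by field_simp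
  rw [h3] at h2
  linarith

/-- Let `q` be the exponential of the logarithmic objective. Then `f = q^(1/α) g^((α-1)/α)` exactly,
so AM-GM bounds the additive objective by `q`, and `y < q`. -/
theorem log_lt_logObj_of_lt_obj {α z : ℝ} (hα : 1 < α) {ρ σ H : E →L[ℂ] E}
    (hH : H ∈ HSetPos α z σ) {y : ℝ} (hy : 0 < y) (h : (y : EReal) < obj α z ρ σ H) :
    (Real.log y : EReal) < logObj α z ρ σ H := by
  have hα1 : 0 < α - 1 := by linarith
  have hα0 : 0 < α := by linarith
  have hg := ENNReal.toReal_pos hH.2.1.ne' hH.2.2.ne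
  by_cases hF : trConj (α / z) ρ H = ∞
  · rw [logObj, hF, ENNReal.log_top, EReal.coe_mul_top_of_pos hα0,
      ENNReal.log_pos_real hH.2.1.ne' hH.2.2.ne, ← EReal.coe_mul, EReal.top_add_coe]
    exact EReal.coe_lt_top _
  rw [obj_eq_coe hF hH.2.2.ne, EReal.coe_lt_coe_iff] at h
  have hF0 : trConj (α / z) ρ H ≠ 0 := by
    intro h0
    rw [h0, ENNReal.toReal_zero] at h
    nlinarith
  have hf := ENNReal.toReal_pos hF0 hF
  rw [logObj_eq_coe hF0 hF hH.2.1.ne' hH.2.2.ne, EReal.coe_lt_coe_iff]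
  generalize (trConj (α / z) ρ H).toReal = f at *
  generalize (trConj ((α - 1) / z) σ H).toReal = g at *
  rw [Real.log_lt_iff_lt_exp hy]
  refine h.trans_le (add_le_of_le_rpow_mul_rpow hα hg.le (Real.exp_pos _).le (le_of_eq ?_))
  rw [← Real.exp_mul, Real.rpow_def_of_pos hg, ← Real.exp_add]
  conv_lhs => rw [← Real.exp_log hf]
  congr 1
  field_simp
  ring

/-! ### The variational formulas. -/

/-- Upper bounds hold on all of `HSet` and near-optimal operators exist in `HSetPos ∩ finRank`, so
any index set in between gives the same supremum. -/
theorem Q_eq_iSup_obj {α z : ℝ} (hα : 1 < α) (hz : 0 < z) {ρ σ : E →L[ℂ] E}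
    (hρ : 0 ≤ ρ) (hρ0 : ρ ≠ 0) (hσ : 0 ≤ σ) (hσ0 : σ ≠ 0) {X : Set (E →L[ℂ] E)}
    (hX : HSetPos α z σ ∩ finRank E ⊆ X) (hX' : X ⊆ HSet α z σ) :
    (Q α z ρ σ : EReal) = ⨆ H ∈ X, obj α z ρ σ H := by
  refine le_antisymm (le_of_forall_lt fun c hc => ?_)
    (iSup₂_le fun H hH => obj_le_Q hα hz hσ (hX' hH))
  -- The lower bound is available at nonnegative levels only; raising `c` to `0` keeps it below `Q`
  -- because `Q > 0`.
  have h0 : max c 0 < (Q α z ρ σ : EReal) :=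
    max_lt hc (EReal.coe_ennreal_pos.2 (Q_pos hα hz hρ hρ0 hσ))
  obtain ⟨y, hcy, hyQ⟩ := EReal.lt_iff_exists_real_btwn.1 h0
  have hy0 : 0 ≤ y := by exact_mod_cast (le_max_right _ _).trans hcy.le
  have hyQ' : ENNReal.ofReal y < Q α z ρ σ := by
    rwa [← EReal.coe_ennreal_lt_coe_ennreal_iff, EReal.coe_ennreal_ofReal, max_eq_left hy0]
  obtain ⟨H, hH, hlt⟩ := exists_lt_obj_of_lt_Q hα hz hρ hρ0 hσ hσ0 hy0 hyQ'
  exact ((le_max_left _ _).trans_lt (hcy.trans hlt)).trans_le (le_iSup₂_of_le H (hX hH) le_rfl)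

theorem log_Q_eq_iSup_logObj {α z : ℝ} (hα : 1 < α) (hz : 0 < z) {ρ σ : E →L[ℂ] E}
    (hρ : 0 ≤ ρ) (hρ0 : ρ ≠ 0) (hσ : 0 ≤ σ) (hσ0 : σ ≠ 0) {X : Set (E →L[ℂ] E)}
    (hX : HSetPos α z σ ∩ finRank E ⊆ X) (hX' : X ⊆ HSetPos α z σ) :
    ENNReal.log (Q α z ρ σ) = ⨆ H ∈ X, logObj α z ρ σ H := by
  refine le_antisymm (le_of_forall_lt fun c hc => ?_)
    (iSup₂_le fun H hH => logObj_le_log_Q hα hz hσ (hX' hH))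
  obtain ⟨x, hcx, hxQ⟩ := EReal.lt_iff_exists_real_btwn.1 hc
  have hlog : ENNReal.log (ENNReal.ofReal (Real.exp x)) = (x : EReal) := by
    rw [ENNReal.log_ofReal_of_pos (Real.exp_pos x), Real.log_exp]
  have hyQ : ENNReal.ofReal (Real.exp x) < Q α z ρ σ := by
    rwa [← ENNReal.log_lt_log_iff, hlog]
  obtain ⟨H, hH, hlt⟩ := exists_lt_obj_of_lt_Q hα hz hρ hρ0 hσ hσ0 (Real.exp_pos x).le hyQ
  have h1 := log_lt_logObj_of_lt_obj hα hH.1 (Real.exp_pos x) hlt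
  rw [Real.log_exp] at h1
  exact (hcx.trans h1).trans_le (le_iSup₂_of_le H (hX hH) le_rfl)

theorem HSetPos_subset_HSet (α z : ℝ) (σ : E →L[ℂ] E) : HSetPos α z σ ⊆ HSet α z σ :=
  fun _ hH => ⟨hH.1, hH.2.2⟩

end RenyiAZ

end

theorem mainTheorem8 {E : Type*} [NormedAddCommGroup E] [InnerProductSpace ℂ E] [CompleteSpace E]
    [TopologicalSpace.SeparableSpace E]
    (ρ σ : E →L[ℂ] E) (hρ : 0 ≤ ρ) (hρ0 : ρ ≠ 0) (hσ : 0 ≤ σ) (hσ0 : σ ≠ 0)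
    (α z : ℝ) (hα : 1 < α) (hz : 0 < z)
    (h : ρ ∉ RenyiAZ.BSet α z σ ∨
      (ρ ∈ RenyiAZ.BSet α z σ \ RenyiAZ.LSet α z σ ∧ IsCompactOperator σ) ∨
      ρ ∈ RenyiAZ.LSet α z σ) :
    (RenyiAZ.Q α z ρ σ : EReal) = (⨆ H ∈ RenyiAZ.HSet α z σ, RenyiAZ.obj α z ρ σ H) ∧
    ENNReal.log (RenyiAZ.Q α z ρ σ) = (⨆ H ∈ RenyiAZ.HSetPos α z σ, RenyiAZ.logObj α z ρ σ H) ∧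
    (RenyiAZ.Q α z ρ σ : EReal) = (⨆ H ∈ RenyiAZ.HSetPos α z σ, RenyiAZ.obj α z ρ σ H) ∧
    ((ρ ∉ RenyiAZ.BSet α z σ ∨
        (ρ ∈ RenyiAZ.BSet α z σ \ RenyiAZ.LSet α z σ ∧ IsCompactOperator σ) ∨
        (ρ ∈ RenyiAZ.LSet α z σ ∧ IsCompactOperator σ)) →
      (RenyiAZ.Q α z ρ σ : EReal) =
        (⨆ H ∈ RenyiAZ.HSet α z σ ∩ RenyiAZ.finRank E, RenyiAZ.obj α z ρ σ H) ∧
      ENNReal.log (RenyiAZ.Q α z ρ σ) =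
        (⨆ H ∈ RenyiAZ.HSetPos α z σ ∩ RenyiAZ.finRank E, RenyiAZ.logObj α z ρ σ H) ∧
      (RenyiAZ.Q α z ρ σ : EReal) =
        (⨆ H ∈ RenyiAZ.HSetPos α z σ ∩ RenyiAZ.finRank E, RenyiAZ.obj α z ρ σ H)) := by
  have hsub := RenyiAZ.HSetPos_subset_HSet α z σ
  refine ⟨RenyiAZ.Q_eq_iSup_obj hα hz hρ hρ0 hσ hσ0 (Set.inter_subset_left.trans hsub) le_rfl,
    RenyiAZ.log_Q_eq_iSup_logObj hα hz hρ hρ0 hσ hσ0 Set.inter_subset_left le_rfl,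
    RenyiAZ.Q_eq_iSup_obj hα hz hρ hρ0 hσ hσ0 Set.inter_subset_left hsub, fun _ => ⟨?_, ?_, ?_⟩⟩
  · exact RenyiAZ.Q_eq_iSup_obj hα hz hρ hρ0 hσ hσ0 (Set.inter_subset_inter_left _ hsub)
      Set.inter_subset_left
  · exact RenyiAZ.log_Q_eq_iSup_logObj hα hz hρ hρ0 hσ hσ0 le_rfl Set.inter_subset_left
  · exact RenyiAZ.Q_eq_iSup_obj hα hz hρ hρ0 hσ hσ0 le_rfl (Set.inter_subset_left.trans hsub)
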